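/- Let $H$ be a separable real Hilbert space and let $X, X_1, X_2, \dots$ be i.i.d. $H$-valued random variables with law $\mu$, centered, nonatomic and with bounded support. Let $\Gamma = \mathbb E[\langle X,\cdot\rangle X]$ be the covariance operator, let $D>2$ be a fixed integer, and let $\lambda_1\ge\lambda_2\ge\cdots$ be the eigenvalues of $\Gamma$, counted with multiplicity, where we assume $\lambda_1>\dots>\lambda_{D}>\lambda_{D+1}$ (the last inequality being void if $\dim H=D$). Let $\Pi_D$ be the orthogonal projection onto the span of the eigenvectors $e_1,\dots,e_D$ associated with $\lambda_1,\dots,\lambda_D$, and let $\hat\Pi_D=\hat\Pi_{D,n}$ be the orthogonal projection onto the span of $D$ orthonormal eigenvectors associated with the $D$ largest eigenvalues (with multiplicity) of the empirical covariance operator $\Gamma_n=\frac1n\sum_{i=1}^n\langle X_i,\cdot\rangle X_i$ (in case of ties, any choice for which $\hat\Pi_D$ is measurable). Let $K:[0,\infty)\to[0,\infty)$ be bounded with support $[0,1]$ and of class $C^1$ on $[0,1]$. For $x\in H$ and $h>0$ put $$F_x(h)=\mathbb P(\|\Pi_D(X-x)\|\le h),$$ and, for a sequence $(h_n)$ of positive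 numbers, $$S_n(x)=\sum_{i=1}^nK\Big(\frac{\|\Pi_D(x-X_i)\|}{h_n}\Big),\qquad \hat S_n(x)=\sum_{i=1}^nK\Big(\frac{\|\hat\Pi_D(x-X_i)\|}{h_n}\Big).$$ Then, for $\mu$-almost every $x$ for which $F_x$ is regularly varying at $0$ with index $D$ (that is, $\lim_{s\to0^+}F_x(su)/F_x(s)=u^D$ for every $u>0$), the following holds: for every sequence of positive numbers $h_n\downarrow0$ with $nF_x(h_n)/\ln n\to\infty$, one has, as $n\to\infty$, $$\hat S_n(x)\sim S_n(x)\ \text{ almost surely},\qquad\text{and}\qquad \mathbb E\hat S_n^2(x)\sim\mathbb E S_n^2(x).$$ -/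

import Mathlib

open MeasureTheory ProbabilityTheory Filter Topology Asymptotics

namespace PCAKernel

variable {H : Type*} [NormedAddCommGroup H] [InnerProductSpace ℝ H]

/-- The covariance operator `Γ v = 𝔼[⟨X, v⟩ X]` of a centered random element with law `μ`. -/
noncomputable def covOp [MeasurableSpace H] (μ : Measure H) (v : H) : H :=
  ∫ y, inner ℝ y v • y ∂μ

/-- The empirical covariance operator `Γ_n v = (1/n) ∑_{i ≤ n} ⟨X_i, v⟩ X_i` of the first `n` terms
of a sequence `x` (the sample points `X_1, …, X_n` are `x 0, …, x (n - 1)`). -/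
noncomputable def empCovOp (x : ℕ → H) (n : ℕ) (v : H) : H :=
  (n : ℝ)⁻¹ • ∑ i ∈ Finset.range n, inner ℝ (x i) v • x i

/-- `e` is an orthonormal family of eigenvectors of `T` with eigenvalues `lam`, listed in
decreasing order, and these are the `D` largest eigenvalues of `T` counted with multiplicity: every
eigenvalue of `T` with an eigenvector orthogonal to all of `e` is at most each `lam i`. -/
structure IsLeadingEigensystem (T : H → H) {D : ℕ} (e : Fin D → H) (lam : Fin D → ℝ) : Prop where
  orthonormal : Orthonormal ℝ e
  eigen : ∀ i, T (e i) = lam i • e i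
  antitone : Antitone lam
  leading : ∀ (v : H) (ν : ℝ), v ≠ 0 → (∀ i, inner ℝ (e i) v = 0) → T v = ν • v →
    ∀ i, ν ≤ lam i

/-- Strict spectral separation `λ_1 > ⋯ > λ_D > λ_{D+1}`: the listed eigenvalues are strictly
decreasing, and every eigenvalue of `T` with an eigenvector orthogonal to all of `e` is strictly
smaller than each of them. -/
structure IsSeparated (T : H → H) {D : ℕ} (e : Fin D → H) (lam : Fin D → ℝ) : Prop where
  strictAnti : StrictAnti lam
  gap : ∀ (v : H) (ν : ℝ), v ≠ 0 → (∀ i, inner ℝ (e i) v = 0) → T v = ν • v → ∀ i, ν < lam i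

instance instFiniteDimensionalSpanRange {D : ℕ} (e : Fin D → H) :
    FiniteDimensional ℝ (Submodule.span ℝ (Set.range e)) :=
  FiniteDimensional.span_of_finite ℝ (Set.finite_range e)

/-- The orthogonal projection of `H` onto the span of `e 0, …, e (D - 1)`. -/
noncomputable def proj {D : ℕ} (e : Fin D → H) : H →L[ℝ] H :=
  (Submodule.span ℝ (Set.range e)).starProjection

/-- The small-ball function `F_x(h) = ℙ(Π X ∈ closed ball of center Π x and radius h)`, where `X`
has law `μ`. -/
noncomputable def smallBall [MeasurableSpace H] (μ : Measure H) (Pi : H →L[ℝ] H) (x : H)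
    (h : ℝ) : ℝ :=
  μ.real {y | Pi y ∈ Metric.closedBall (Pi x) h}

/-- `G` is regularly varying at `0` with index `D`: `G(su)/G(s) → u^D` as `s → 0+`, for all
`u > 0`. -/
def RegularlyVaryingAtZero (G : ℝ → ℝ) (D : ℕ) : Prop :=
  ∀ u : ℝ, 0 < u → Tendsto (fun s => G (s * u) / G s) (𝓝[>] 0) (𝓝 (u ^ D))

/-- The conditions on the kernel `K : [0, ∞) → [0, ∞)`: bounded, with support `[0, 1]`, and of
class `C¹` on `[0, 1]`. Only the values of `K` on `[0, ∞)` matter. -/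
structure IsKernel (K : ℝ → ℝ) : Prop where
  nonneg : ∀ v, 0 ≤ v → 0 ≤ K v
  bounded : ∃ C, ∀ v, 0 ≤ v → K v ≤ C
  support : closure {v | 0 ≤ v ∧ K v ≠ 0} = Set.Icc 0 1
  contDiff : ContDiffOn ℝ 1 K (Set.Icc 0 1)

/-- The kernel sum `∑_{i ≤ n} K(‖Π(x - X_i)‖ / h)` at the point `x`, over the first `n` terms of the
sequence `xs`. -/
noncomputable def kernelSum (K : ℝ → ℝ) (Pi : H →L[ℝ] H) (xs : ℕ → H) (x : H) (n : ℕ)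
    (h : ℝ) : ℝ :=
  ∑ i ∈ Finset.range n, K (‖Pi (x - xs i)‖ / h)

end PCAKernel

/-! The conclusion holds at every `x` where `F_x` is regularly varying. The mechanism is that the
random projector moves distances on the sample by only `o(h_n)`, so the two kernel sums can disagree
only through a small Lipschitz error and through points in a thin shell around radius `h_n`.

Bandwidths cannot be too small: an integer index `D > 2` exceeds `5/2`, so `F_x(s) = O(s^(5/2))`,
and `n F_x(h_n) ≥ log n` then forces `n h_n² ≥ c n^(1/5)` (`exists_inv_pow_bandwidth_le`). The
empirical covariance fluctuates at scale `n^(-1/2)`, which is much smaller than `h_n`. A moment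
bound of order 20 in the Hilbert tensor square makes a deviation of size `η h_n` have probability
`O((n h_n²)^(-10)) = O(n^(-2))` (`exists_covariance_deviation`). The spectral gap turns this into a
bound on projected norms, by a Weyl inequality followed by a Davis–Kahan estimate
(`abs_norm_proj_sub_norm_proj_le`). Hence distances differ by at most `ε h_n`, simultaneously for
all sample points, off an event of probability `O(n^(-2))` (`isNegligiblePerturbation_proj`).

Off that event the difference of the sums is at most `L ε` times the number of points in the ball
plus `C` times the number in the shell of radii `(1 ± ε) h_n` (`abs_kernelSum_sub_le`). Chernoff and
Borel–Cantelli replace counts by their means, and regular variation makes these `n F_x(h_n)` and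
`((1 + ε)^D - (1 - ε)^D) n F_x(h_n)`. Since `K` is bounded below on some interval inside `(0, 1)`,
the original sum is at least a fixed multiple of `n F_x(h_n)`; letting `ε → 0` gives almost sure
equivalence. For second moments the same comparison is made in `L²`: the bad event costs at most `(C
n)² O(n^(-2)) = O(1)`, negligible against `(n F_x(h_n))² → ∞`. -/

namespace PCAKernel

/-! ### Spectral perturbation: Rayleigh quotients, Weyl and Davis–Kahan. -/

section Spectral

variable {H : Type*} [NormedAddCommGroup H] [InnerProductSpace ℝ H] {D : ℕ}

theorem inner_sub_sum_eq_zero {e : Fin D → H} (he : Orthonormal ℝ e) (v : H) (i : Fin D) :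
    inner ℝ (e i) (v - ∑ j, inner ℝ (e j) v • e j) = 0 := by
  rw [inner_sub_right, he.inner_right_fintype, sub_self]

theorem proj_apply {e : Fin D → H} (he : Orthonormal ℝ e) (v : H) :
    proj e v = ∑ i, inner ℝ (e i) v • e i := by
  unfold proj
  refine Submodule.eq_starProjection_of_mem_orthogonal ?_ ?_
  · exact Submodule.sum_mem _ fun i _ =>
      Submodule.smul_mem _ _ (Submodule.subset_span (Set.mem_range_self i))
  · rw [Submodule.mem_orthogonal]
    intro u hu
    induction hu using Submodule.span_induction with
    | mem x hx =>
      obtain ⟨i, rfl⟩ := hx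
      exact inner_sub_sum_eq_zero he v i
    | zero => simp
    | add x y _ _ hx hy => rw [inner_add_left, hx, hy, add_zero]
    | smul a x _ hx => rw [inner_smul_left, hx, mul_zero]

theorem inner_sub_proj {e : Fin D → H} (he : Orthonormal ℝ e) (v : H) (i : Fin D) :
    inner ℝ (e i) (v - proj e v) = 0 := by
  rw [proj_apply he, inner_sub_sum_eq_zero he]

theorem inner_proj_left (e : Fin D → H) (v w : H) :
    inner ℝ (proj e v) w = inner ℝ v (proj e w) :=
  Submodule.inner_starProjection_left_eq_right _ v w

theorem proj_eq_zero_of_inner {e : Fin D → H} (he : Orthonormal ℝ e) {v : H}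
    (hv : ∀ i, inner ℝ (e i) v = 0) : proj e v = 0 := by
  rw [proj_apply he]; simp [hv]

theorem norm_proj_sq {e : Fin D → H} (he : Orthonormal ℝ e) (v : H) :
    ‖proj e v‖ ^ 2 = ∑ i, inner ℝ (e i) v ^ 2 := by
  rw [← real_inner_self_eq_norm_sq, proj_apply he, he.inner_sum]
  simp [pow_two]

theorem norm_sub_proj_sq {e : Fin D → H} (he : Orthonormal ℝ e) (v : H) :
    ‖v - proj e v‖ ^ 2 = ‖v‖ ^ 2 - ∑ i, inner ℝ (e i) v ^ 2 := by
  have h0 : inner ℝ (proj e v) (v - proj e v) = 0 := by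
    rw [proj_apply he, sum_inner]
    refine Finset.sum_eq_zero fun i _ => ?_
    rw [inner_smul_left, inner_sub_sum_eq_zero he, mul_zero]
  have h1 : ‖v‖ ^ 2 = ‖proj e v‖ ^ 2 + ‖v - proj e v‖ ^ 2 := by
    conv_lhs => rw [← add_sub_cancel (proj e v) v]
    rw [norm_add_sq_real, h0]; ring
  rw [norm_proj_sq he] at h1
  linarith

theorem proj_norm_le (e : Fin D → H) (v : H) : ‖proj e v‖ ≤ ‖v‖ :=
  Submodule.norm_starProjection_apply_le _ v

/-- Cauchy–Schwarz for the form of a bounded nonnegative symmetric operator. -/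
theorem norm_apply_sq_le_of_nonneg (B : H →L[ℝ] H) (hsymm : ∀ v w, inner ℝ (B v) w = inner ℝ v (B w))
    (hpos : ∀ v, 0 ≤ inner ℝ (B v) v) (x : H) : ‖B x‖ ^ 2 ≤ ‖B‖ * inner ℝ (B x) x := by
  rcases (norm_nonneg B).eq_or_lt with h0 | h0
  · have : B = 0 := norm_eq_zero.1 h0.symm
    simp [this]
  -- A gradient step of length `1 / ‖B‖`: nonnegativity of the form there is the claimed inequality
  -- after bounding the quadratic term by `‖B‖ ‖B x‖²`.
  have h1 := hpos (x - (‖B‖)⁻¹ • B x)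
  have h2 : inner ℝ (B (B x)) (B x) ≤ ‖B‖ * ‖B x‖ ^ 2 := by
    refine (real_inner_le_norm _ _).trans ?_
    have := B.le_opNorm (B x)
    nlinarith [norm_nonneg (B x)]
  have h3 : inner ℝ (B (B x)) x = ‖B x‖ ^ 2 := by
    rw [hsymm, real_inner_self_eq_norm_sq]
  simp only [map_sub, map_smul, inner_sub_left, inner_sub_right, inner_smul_left, inner_smul_right,
    real_inner_self_eq_norm_sq, h3] at h1
  simp only [conj_trivial] at h1
  have h4 : ‖B‖⁻¹ * (‖B‖⁻¹ * inner ℝ (B (B x)) (B x)) ≤ ‖B‖⁻¹ * ‖B x‖ ^ 2 := by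
    have : ‖B‖⁻¹ * inner ℝ (B (B x)) (B x) ≤ ‖B x‖ ^ 2 := by
      rw [inv_mul_le_iff₀ h0]; exact h2
    exact mul_le_mul_of_nonneg_left this (by positivity)
  have h5 : ‖B‖⁻¹ * ‖B x‖ ^ 2 ≤ inner ℝ (B x) x := by nlinarith
  rwa [inv_mul_le_iff₀ h0] at h5

/-- On the orthogonal complement of some of its eigenvectors, the Rayleigh quotient of a compact
nonnegative symmetric operator is maximal at an eigenvector. -/
theorem exists_maximal_eigenvector (G : H →L[ℝ] H) (hcomp : IsCompactOperator G)
    (hsymm : ∀ v w, inner ℝ (G v) w = inner ℝ v (G w)) (hpos : ∀ v, 0 ≤ inner ℝ (G v) v)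
    {e : Fin D → H} {lam : Fin D → ℝ} (he : Orthonormal ℝ e) (heig : ∀ i, G (e i) = lam i • e i)
    {v₀ : H} (hv₀ : v₀ ≠ 0) (hv₀e : ∀ i, inner ℝ (e i) v₀ = 0) :
    ∃ (v : H) (ν : ℝ), v ≠ 0 ∧ (∀ i, inner ℝ (e i) v = 0) ∧ G v = ν • v ∧
      ∀ w, (∀ i, inner ℝ (e i) w = 0) → inner ℝ (G w) w ≤ ν * ‖w‖ ^ 2 := by
  set S : Set ℝ := {r | ∃ w, (∀ i, inner ℝ (e i) w = 0) ∧ ‖w‖ = 1 ∧ r = inner ℝ (G w) w} with hS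
  have hbdd : BddAbove S := by
    refine ⟨‖G‖, ?_⟩
    rintro r ⟨w, -, hw, rfl⟩
    refine (real_inner_le_norm _ _).trans ?_
    have := G.le_opNorm w
    simpa [hw] using this
  have hmax : ∀ w, (∀ i, inner ℝ (e i) w = 0) → inner ℝ (G w) w ≤ sSup S * ‖w‖ ^ 2 := by
    intro w hw
    rcases eq_or_ne w 0 with rfl | hw0
    · simp
    have hn : 0 < ‖w‖ := norm_pos_iff.2 hw0
    have hmem : inner ℝ (G (‖w‖⁻¹ • w)) (‖w‖⁻¹ • w) ∈ S :=
      ⟨‖w‖⁻¹ • w, fun i => by rw [inner_smul_right, hw, mul_zero],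
        by rw [norm_smul, norm_inv, norm_norm, inv_mul_cancel₀ hn.ne'], rfl⟩
    have := le_csSup hbdd hmem
    rw [map_smul, inner_smul_left, inner_smul_right, conj_trivial, ← mul_assoc, ← mul_inv,
      inv_mul_le_iff₀ (by positivity)] at this
    nlinarith
  have hM0 : 0 ≤ sSup S := by
    have h1 := hmax v₀ hv₀e
    have h2 := hpos v₀
    have h3 : 0 < ‖v₀‖ ^ 2 := by positivity
    by_contra hneg
    nlinarith
  have hSne : S.Nonempty :=
    ⟨_, ‖v₀‖⁻¹ • v₀, fun i => by rw [inner_smul_right, hv₀e, mul_zero],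
        by rw [norm_smul, norm_inv, norm_norm, inv_mul_cancel₀ (norm_ne_zero_iff.2 hv₀)], rfl⟩
  rcases hM0.eq_or_lt with hM | hM
  -- If the supremum is zero, the form vanishes at `v₀`, and Cauchy–Schwarz for the form gives `G v₀
  -- = 0`.
  · refine ⟨v₀, 0, hv₀, hv₀e, ?_, fun w hw => by simpa [← hM] using hmax w hw⟩
    have h1 := norm_apply_sq_le_of_nonneg G hsymm hpos v₀
    have h2 := hmax v₀ hv₀e
    rw [← hM, zero_mul] at h2
    have h3 : ‖G‖ * inner ℝ (G v₀) v₀ ≤ 0 := mul_nonpos_of_nonneg_of_nonpos (norm_nonneg _) h2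
    have h4 : ‖G v₀‖ = 0 := by
      have : ‖G v₀‖ ^ 2 = 0 := le_antisymm (h1.trans h3) (by positivity)
      simpa using this
    simpa using h4
  · set M := sSup S
    set Q : H →L[ℝ] H := 1 - proj e with hQ
    have hQapp : ∀ v, Q v = v - proj e v := fun v => rfl
    have hQe : ∀ v i, inner ℝ (e i) (Q v) = 0 := fun v i => inner_sub_proj he v i
    have hQsymm : ∀ v w, inner ℝ (Q v) w = inner ℝ v (Q w) := fun v w => by
      rw [hQapp, hQapp, inner_sub_left, inner_sub_right, inner_proj_left]
    have hQfix : ∀ v, (∀ i, inner ℝ (e i) v = 0) → Q v = v := fun v hv => by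
      rw [hQapp, proj_eq_zero_of_inner he hv, sub_zero]
    have hQnorm : ∀ v, ‖Q v‖ ^ 2 ≤ ‖v‖ ^ 2 := fun v => by
      rw [hQapp, norm_sub_proj_sq he]
      have : 0 ≤ ∑ i, inner ℝ (e i) v ^ 2 := Finset.sum_nonneg fun i _ => sq_nonneg _
      linarith
    -- Compression to the complement: an eigenvector of `A` for `M ≠ 0` lies in the range of `Q`, so
    -- it is orthogonal to `e`, and there `A` acts as `G`.
    set A : H →L[ℝ] H := Q ∘L G ∘L Q with hA
    have hAcomp : IsCompactOperator A := by
      have := (hcomp.comp_clm Q).clm_comp Q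
      exact this
    have hAapp : ∀ v, A v = Q (G (Q v)) := fun v => rfl
    by_cases hev : Module.End.HasEigenvalue (A : Module.End ℝ H) M
    · obtain ⟨v, hv⟩ := hev.exists_hasEigenvector
      have hv0 := hv.2
      have hAv : A v = M • v := hv.apply_eq_smul
      have hve : ∀ i, inner ℝ (e i) v = 0 := fun i => by
        have : inner ℝ (e i) (A v) = 0 := hQe _ i
        rw [hAv, inner_smul_right] at this
        exact (mul_eq_zero.1 this).resolve_left hM.ne'
      refine ⟨v, M, hv0, hve, ?_, hmax⟩
      rw [← hAv, hAapp, hQfix v hve, hQfix]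
      intro i
      rw [← hsymm, heig, inner_smul_left, hve, mul_zero]
    · exfalso
      -- Fredholm alternative: `A - M` is bounded below. Cauchy–Schwarz for the form of `M - A` then
      -- bounds that form below by a multiple of `‖v‖²`, contradicting unit vectors whose Rayleigh
      -- quotients approach `M`.
      obtain ⟨C, hC⟩ := hAcomp.antilipschitz_of_not_hasEigenvalue hM.ne' hev
      set B : H →L[ℝ] H := M • 1 - A with hB
      have hBapp : ∀ v, B v = M • v - A v := fun v => rfl
      have hBinner : ∀ v, inner ℝ (B v) v = M * ‖v‖ ^ 2 - inner ℝ (G (Q v)) (Q v) := fun v => by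
        rw [hBapp, inner_sub_left, inner_smul_left, real_inner_self_eq_norm_sq, hAapp, hQsymm,
          conj_trivial]
      have hBsymm : ∀ v w, inner ℝ (B v) w = inner ℝ v (B w) := fun v w => by
        rw [hBapp, hBapp, inner_sub_left, inner_sub_right, inner_smul_left, inner_smul_right,
          hAapp, hAapp, hQsymm, hsymm, hQsymm, conj_trivial]
      have hBpos : ∀ v, 0 ≤ inner ℝ (B v) v := fun v => by
        rw [hBinner]
        have h1 := hmax (Q v) (hQe v)
        have h2 := mul_le_mul_of_nonneg_left (hQnorm v) hM.le
        linarith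
      have hlow : ∀ v, ‖v‖ ^ 2 ≤ (C : ℝ) ^ 2 * (‖B‖ * inner ℝ (B v) v) := fun v => by
        have h1 := hC.le_mul_dist v 0
        rw [map_zero, dist_zero_right, dist_zero_right] at h1
        have h2 : ‖(A - M • 1) v‖ = ‖B v‖ := by
          rw [← norm_neg]; congr 1; simp [hB]
        rw [h2] at h1
        calc ‖v‖ ^ 2 ≤ (C * ‖B v‖) ^ 2 := by gcongr
          _ = (C : ℝ) ^ 2 * ‖B v‖ ^ 2 := by ring
          _ ≤ _ := by
            gcongr
            exact norm_apply_sq_le_of_nonneg B hBsymm hBpos v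
      set c := (C : ℝ) ^ 2 * ‖B‖ with hc
      have hc0 : 0 ≤ c := by positivity
      obtain ⟨r, ⟨w, hwe, hw1, rfl⟩, hr⟩ := exists_lt_of_lt_csSup hSne
        (show M - (c + 1)⁻¹ < M from sub_lt_self _ (by positivity))
      have h1 := hlow w
      rw [hBinner, hQfix w hwe, hw1, ← mul_assoc] at h1
      have h2 : c * (M * 1 ^ 2 - inner ℝ (G w) w) ≤ c * (c + 1)⁻¹ := by
        gcongr; linarith
      have h3 : c * (c + 1)⁻¹ < 1 := by
        rw [← div_eq_mul_inv, div_lt_one (by positivity)]; linarith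
      linarith

/-- The `leading` field constrains only eigenvectors; since the supremum of the form on the
complement is an eigenvalue, it controls all vectors there. -/
theorem IsLeadingEigensystem.rayleigh_le {G : H →L[ℝ] H} (hcomp : IsCompactOperator G)
    (hsymm : ∀ v w, inner ℝ (G v) w = inner ℝ v (G w)) (hpos : ∀ v, 0 ≤ inner ℝ (G v) v)
    {e : Fin D → H} {lam : Fin D → ℝ} (he : IsLeadingEigensystem G e lam)
    {w : H} (hw : ∀ i, inner ℝ (e i) w = 0) (i : Fin D) :
    inner ℝ (G w) w ≤ lam i * ‖w‖ ^ 2 := by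
  rcases eq_or_ne w 0 with rfl | hw0
  · simp
  obtain ⟨v, ν, hv, hve, hvν, hmax⟩ :=
    exists_maximal_eigenvector G hcomp hsymm hpos he.orthonormal he.eigen hw0 hw
  refine (hmax w hw).trans ?_
  gcongr
  exact he.leading v ν hv hve hvν i

/-- The supremum on the complement is attained at an eigenvector, so strict separation of
eigenvalues becomes a uniform gap. If the complement is trivial, any gap will do. -/
theorem IsSeparated.exists_rayleigh_gap {G : H →L[ℝ] H} (hcomp : IsCompactOperator G)
    (hsymm : ∀ v w, inner ℝ (G v) w = inner ℝ v (G w)) (hpos : ∀ v, 0 ≤ inner ℝ (G v) v)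
    {e : Fin D → H} {lam : Fin D → ℝ} (he : IsLeadingEigensystem G e lam)
    (hsep : IsSeparated G e lam) (hD : 0 < D) :
    ∃ (g t : ℝ), 0 < g ∧ (∀ i, t ≤ lam i) ∧
      ∀ w, (∀ i, inner ℝ (e i) w = 0) → inner ℝ (G w) w ≤ (t - g) * ‖w‖ ^ 2 := by
  have : Nonempty (Fin D) := ⟨⟨0, hD⟩⟩
  obtain ⟨i₀, hi₀⟩ := Finite.exists_min lam
  by_cases hex : ∃ v₀ : H, v₀ ≠ 0 ∧ ∀ i, inner ℝ (e i) v₀ = 0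
  · obtain ⟨v₀, hv₀, hv₀e⟩ := hex
    obtain ⟨v, ν, hv, hve, hvν, hmax⟩ :=
      exists_maximal_eigenvector G hcomp hsymm hpos he.orthonormal he.eigen hv₀ hv₀e
    refine ⟨lam i₀ - ν, lam i₀, sub_pos.2 (hsep.gap v ν hv hve hvν i₀), hi₀, fun w hw => ?_⟩
    rw [sub_sub_cancel]
    exact hmax w hw
  · push Not at hex
    refine ⟨1, lam i₀, one_pos, hi₀, fun w hw => ?_⟩
    have : w = 0 := by
      by_contra h0
      obtain ⟨i, hi⟩ := hex w h0
      exact hi (hw i)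
    simp [this]

/-- Some nontrivial combination of `D` vectors is orthogonal to `D - 1` given vectors. -/
theorem exists_combination_orthogonal (e u : Fin D → H) (j : Fin D) :
    ∃ c : Fin D → ℝ, c ≠ 0 ∧ ∀ k, k ≠ j → inner ℝ (u k) (∑ i, c i • e i) = 0 := by
  classical
  -- Zeroing row `j` keeps the matrix square and makes it singular, so a kernel vector solves the
  -- remaining `D - 1` equations.
  let M : Matrix (Fin D) (Fin D) ℝ := fun k i => if k = j then 0 else inner ℝ (u k) (e i)
  have hdet : M.det = 0 := Matrix.det_eq_zero_of_row_eq_zero j fun i => by simp [M]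
  obtain ⟨c, hc, hMc⟩ := Matrix.exists_mulVec_eq_zero_iff.2 hdet
  refine ⟨c, hc, fun k hk => ?_⟩
  have := congrFun hMc k
  simp only [Matrix.mulVec, dotProduct, Pi.zero_apply, M, if_neg hk] at this
  rw [inner_sum, ← this]
  exact Finset.sum_congr rfl fun i _ => by rw [inner_smul_right, mul_comm]

/-- Weyl's inequality for the leading eigenvalues of a perturbed operator. -/
theorem sub_le_perturbed_eigenvalue {T T' : H →L[ℝ] H} {e u : Fin D → H} {lam lam' : Fin D → ℝ}
    {δ t : ℝ} (he : Orthonormal ℝ e) (hu : Orthonormal ℝ u) (hTe : ∀ i, T (e i) = lam i • e i)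
    (hTu : ∀ i, T' (u i) = lam' i • u i) (ht : ∀ i, t ≤ lam i)
    (hT'symm : ∀ v w, inner ℝ (T' v) w = inner ℝ v (T' w))
    (hT' : ∀ w, (∀ i, inner ℝ (u i) w = 0) → ∀ i, inner ℝ (T' w) w ≤ lam' i * ‖w‖ ^ 2)
    (hδ : ∀ v, ‖T' v - T v‖ ≤ δ * ‖v‖) (j : Fin D) : t - δ ≤ lam' j := by
  -- Min-max test vector: in the span of `e` the form of `T` is at least `t`, while orthogonally to
  -- the `u k`, `k ≠ j`, the form of `T'` is at most `lam' j`.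
  obtain ⟨c, hc, hcu⟩ := exists_combination_orthogonal e u j
  set v := ∑ i, c i • e i with hv
  have hvn : ‖v‖ ^ 2 = ∑ i, c i ^ 2 := by
    rw [← real_inner_self_eq_norm_sq, hv, he.inner_sum]
    simp [pow_two]
  have hvpos : 0 < ‖v‖ ^ 2 := by
    rw [hvn]
    obtain ⟨i, hi⟩ := Function.ne_iff.1 hc
    exact Finset.sum_pos' (fun i _ => sq_nonneg _) ⟨i, Finset.mem_univ i, by
      have : c i ≠ 0 := hi
      positivity⟩
  have hTv : t * ‖v‖ ^ 2 ≤ inner ℝ (T v) v := by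
    have : T v = ∑ i, (c i * lam i) • e i := by
      rw [hv, map_sum]
      exact Finset.sum_congr rfl fun i _ => by rw [map_smul, hTe, smul_smul]
    rw [this, hvn, hv, he.inner_sum, Finset.mul_sum]
    refine Finset.sum_le_sum fun i _ => ?_
    have := mul_le_mul_of_nonneg_right (ht i) (sq_nonneg (c i))
    simp only [conj_trivial]
    linarith
  have hdiff : inner ℝ (T v) v - δ * ‖v‖ ^ 2 ≤ inner ℝ (T' v) v := by
    have h1 : inner ℝ (T v - T' v) v ≤ ‖T v - T' v‖ * ‖v‖ := real_inner_le_norm _ _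
    have h2 : ‖T v - T' v‖ * ‖v‖ ≤ δ * ‖v‖ * ‖v‖ := by
      rw [norm_sub_rev]
      exact mul_le_mul_of_nonneg_right (hδ v) (norm_nonneg _)
    rw [inner_sub_left] at h1
    nlinarith
  have hup : inner ℝ (T' v) v ≤ lam' j * ‖v‖ ^ 2 := by
    set a := inner ℝ (u j) v with ha
    set w := v - a • u j with hw
    have hwu : ∀ k, inner ℝ (u k) w = 0 := fun k => by
      rw [hw, inner_sub_right, inner_smul_right]
      by_cases hk : k = j
      · rw [hk, real_inner_self_eq_norm_sq, hu.1]; simp [ha]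
      · rw [hcu k hk, hu.2 hk]; simp
    have hvw : v = a • u j + w := by rw [hw]; abel
    have h1 : ‖v‖ ^ 2 = a ^ 2 + ‖w‖ ^ 2 := by
      rw [hvw, norm_add_sq_real, inner_smul_left, hwu, norm_smul, hu.1]
      simp
    have h2 : inner ℝ (T' w) (u j) = 0 := by
      rw [hT'symm, hTu, inner_smul_right, real_inner_comm, hwu, mul_zero]
    have h3 : inner ℝ (T' v) v = lam' j * a ^ 2 + inner ℝ (T' w) w := by
      rw [hvw]
      simp only [map_add, map_smul, hTu, inner_add_left, inner_add_right, inner_smul_left,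
        inner_smul_right, h2, hwu, real_inner_self_eq_norm_sq, hu.1, conj_trivial]
      ring
    rw [h3, h1]
    have := hT' w hwu j
    linarith
  have : (t - δ) * ‖v‖ ^ 2 ≤ lam' j * ‖v‖ ^ 2 := by linarith
  exact le_of_mul_le_mul_right this hvpos

/-- A Davis–Kahan bound for each perturbed leading eigenvector. -/
theorem norm_perturbed_eigenvector_sub_proj_le {T T' : H →L[ℝ] H} {e : Fin D → H}
    {lam : Fin D → ℝ} {δ t g μ' : ℝ} {u : H} (he : Orthonormal ℝ e)
    (hTe : ∀ i, T (e i) = lam i • e i) (hu : ‖u‖ = 1) (hTu : T' u = μ' • u) (hg : 0 < g)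
    (hT : ∀ w, (∀ i, inner ℝ (e i) w = 0) → inner ℝ (T w) w ≤ (t - g) * ‖w‖ ^ 2)
    (hδ : ∀ v, ‖T' v - T v‖ ≤ δ * ‖v‖) (hδg : δ ≤ g / 2) (hμ' : t - δ ≤ μ') :
    ‖u - proj e u‖ ≤ 2 / g * δ := by
  set r := u - proj e u with hr
  have hre : ∀ i, inner ℝ (e i) r = 0 := fun i => inner_sub_proj he u i
  have hpr : inner ℝ (proj e u) r = 0 := by
    rw [inner_proj_left, proj_eq_zero_of_inner he hre, inner_zero_right]
  have hTpr : inner ℝ (T (proj e u)) r = 0 := by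
    rw [proj_apply he, map_sum, sum_inner]
    refine Finset.sum_eq_zero fun i _ => ?_
    rw [map_smul, hTe, inner_smul_left, inner_smul_left, hre]; simp
  have hur : u = proj e u + r := by rw [hr]; abel
  -- The span of `e` is `T`-invariant, so pairing with the residual removes the component in the
  -- span. The gap makes the right side at least `(g / 2) ‖r‖²`.
  have h1 : inner ℝ (T' u - T u) r = μ' * ‖r‖ ^ 2 - inner ℝ (T r) r := by
    rw [hTu, inner_sub_left, inner_smul_left]
    conv_lhs => rw [hur]
    rw [map_add, inner_add_left, inner_add_left, hpr, hTpr, real_inner_self_eq_norm_sq]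
    simp
  have h2 : inner ℝ (T' u - T u) r ≤ δ * ‖r‖ := by
    refine (real_inner_le_norm _ _).trans ?_
    have := hδ u
    rw [hu, mul_one] at this
    exact mul_le_mul_of_nonneg_right this (norm_nonneg _)
  have h3 := hT r hre
  have h4 : g / 2 * ‖r‖ ^ 2 ≤ δ * ‖r‖ := by
    have : g / 2 * ‖r‖ ^ 2 ≤ (μ' - (t - g)) * ‖r‖ ^ 2 := by
      gcongr; linarith
    linarith
  rcases (norm_nonneg r).eq_or_lt with h0 | h0
  · rw [← h0]
    have : 0 ≤ δ := by
      have := (norm_nonneg _).trans (hδ u)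
      rwa [hu, mul_one] at this
    positivity
  · have h5 : g / 2 * ‖r‖ ≤ δ := by
      refine le_of_mul_le_mul_right ?_ h0
      nlinarith
    rw [div_mul_eq_mul_div, le_div_iff₀ hg]
    linarith

/-- The sum is the squared Hilbert–Schmidt norm of `(1 - proj u) ∘ proj e`, which dominates the
operator norm of its adjoint `proj e ∘ (1 - proj u)`. -/
theorem norm_proj_sub_le_aux {e u : Fin D → H} (he : Orthonormal ℝ e) {ρ : ℝ} (hρ : 0 ≤ ρ)
    (h : ∑ i, ‖e i - proj u (e i)‖ ^ 2 ≤ ρ ^ 2) (v : H) :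
    ‖proj e v‖ ≤ ‖proj u v‖ + ρ * ‖v‖ := by
  have h1 : proj e v = proj e (proj u v) + proj e (v - proj u v) := by
    rw [← map_add]; congr 1; abel
  have h2 : ‖proj e (v - proj u v)‖ ^ 2 ≤ (ρ * ‖v‖) ^ 2 := by
    rw [norm_proj_sq he, mul_pow]
    refine le_trans ?_ (mul_le_mul_of_nonneg_right h (sq_nonneg ‖v‖))
    rw [Finset.sum_mul]
    refine Finset.sum_le_sum fun i _ => ?_
    have : inner ℝ (e i) (v - proj u v) = inner ℝ (e i - proj u (e i)) v := by
      rw [inner_sub_left, inner_sub_right, inner_proj_left]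
    rw [this, ← mul_pow, ← sq_abs]
    gcongr
    exact abs_real_inner_le_norm _ _
  have h3 : ‖proj e (v - proj u v)‖ ≤ ρ * ‖v‖ := by
    refine (sq_le_sq₀ (norm_nonneg _) (by positivity)).1 h2
  calc ‖proj e v‖ ≤ ‖proj e (proj u v)‖ + ‖proj e (v - proj u v)‖ := by
        rw [h1]; exact norm_add_le _ _
    _ ≤ _ := add_le_add (proj_norm_le _ _) h3

/-- Both sides equal `D - ∑ ⟨e i, u j⟩²`. Thus estimating the perturbed eigenvectors alone bounds
the norms in both directions. -/
theorem sum_norm_sub_proj_sq_comm {e u : Fin D → H} (he : Orthonormal ℝ e) (hu : Orthonormal ℝ u) :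
    ∑ i, ‖e i - proj u (e i)‖ ^ 2 = ∑ i, ‖u i - proj e (u i)‖ ^ 2 := by
  simp only [norm_sub_proj_sq he, norm_sub_proj_sq hu, he.1, hu.1, Finset.sum_sub_distrib]
  rw [Finset.sum_comm]
  simp only [real_inner_comm]

/-- The projections onto the leading eigenspaces of a perturbed operator have norms close to those
of the original operator. -/
theorem abs_norm_proj_sub_norm_proj_le {T T' : H →L[ℝ] H} {e u : Fin D → H}
    {lam lam' : Fin D → ℝ} {δ t g : ℝ} (he : Orthonormal ℝ e) (hu : Orthonormal ℝ u)
    (hTe : ∀ i, T (e i) = lam i • e i)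
    (hTu : ∀ i, T' (u i) = lam' i • u i) (ht : ∀ i, t ≤ lam i) (hg : 0 < g)
    (hT'symm : ∀ v w, inner ℝ (T' v) w = inner ℝ v (T' w))
    (hT : ∀ w, (∀ i, inner ℝ (e i) w = 0) → inner ℝ (T w) w ≤ (t - g) * ‖w‖ ^ 2)
    (hT' : ∀ w, (∀ i, inner ℝ (u i) w = 0) → ∀ i, inner ℝ (T' w) w ≤ lam' i * ‖w‖ ^ 2)
    (hδ0 : 0 ≤ δ) (hδ : ∀ v, ‖T' v - T v‖ ≤ δ * ‖v‖) (hδg : δ ≤ g / 2) (v : H) :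
    |‖proj u v‖ - ‖proj e v‖| ≤ Real.sqrt D * (2 / g * δ) * ‖v‖ := by
  have hsum : ∑ i, ‖u i - proj e (u i)‖ ^ 2 ≤ (Real.sqrt D * (2 / g * δ)) ^ 2 := by
    rw [mul_pow, Real.sq_sqrt (Nat.cast_nonneg D)]
    calc ∑ i, ‖u i - proj e (u i)‖ ^ 2 ≤ ∑ _i : Fin D, (2 / g * δ) ^ 2 := by
          refine Finset.sum_le_sum fun i _ => ?_
          gcongr
          exact norm_perturbed_eigenvector_sub_proj_le he hTe (hu.1 i) (hTu i) hg hT hδ hδg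
            (sub_le_perturbed_eigenvalue he hu hTe hTu ht hT'symm hT' hδ i)
      _ = _ := by simp
  have hρ : 0 ≤ Real.sqrt D * (2 / g * δ) := by positivity
  have h1 := norm_proj_sub_le_aux hu hρ hsum v
  have h2 := norm_proj_sub_le_aux he hρ ((sum_norm_sub_proj_sq_comm he hu).trans_le hsum) v
  rw [abs_le]
  constructor <;> linarith

end Spectral

/-! ### Even moments of sums of independent centered Hilbert-valued variables. -/

section Moments

theorem one_add_pow_le_quadratic (m : ℕ) : ∃ C : ℝ, 0 ≤ C ∧ ∀ x : ℝ, -1 ≤ x → x ≤ 3 →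
    (1 + x) ^ m ≤ 1 + m * x + C * x ^ 2 := by
  induction m with
  | zero => exact ⟨0, le_rfl, fun x _ _ => by simp⟩
  | succ m ih =>
    obtain ⟨C, hC, h⟩ := ih
    refine ⟨m + 4 * C, by positivity, fun x h1 h2 => ?_⟩
    have h3 := mul_le_mul_of_nonneg_right (h x h1 h2) (by linarith : 0 ≤ 1 + x)
    have h4 : C * x ^ 2 * (1 + x) ≤ C * x ^ 2 * 4 := by
      gcongr; linarith
    rw [pow_succ]
    push_cast
    nlinarith

/-- One step of the recursion for even moments of sums in a Hilbert space. -/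
theorem norm_add_sq_add_pow_le (q : ℕ) : ∃ c : ℝ, 0 ≤ c ∧
    ∀ {G : Type*} [NormedAddCommGroup G] [InnerProductSpace ℝ G] (b N : ℝ) (s y : G),
      0 < b → 1 ≤ N → ‖y‖ ≤ b →
      (‖s + y‖ ^ 2 + b ^ 2 * N) ^ (q + 1) ≤ (1 + c / N) * (‖s‖ ^ 2 + b ^ 2 * N) ^ (q + 1) +
        2 * (q + 1) * ((‖s‖ ^ 2 + b ^ 2 * N) ^ q * inner ℝ s y) := by
  obtain ⟨C, hC, hCx⟩ := one_add_pow_le_quadratic (q + 1)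
  refine ⟨(q + 1) + 4 * C, by positivity, fun {G} _ _ b N s y hb hN hy => ?_⟩
  have hN0 : 0 < N := by linarith
  -- The shift `b² N` keeps the relative change `Δ / A` of order `N^(-1/2)`, so the quadratic
  -- remainder costs only a factor `1 + c / N`.
  set A := ‖s‖ ^ 2 + b ^ 2 * N with hA
  have hApos : 0 < A := by positivity
  set Δ := 2 * inner ℝ s y + ‖y‖ ^ 2 with hΔ
  have hsum : ‖s + y‖ ^ 2 + b ^ 2 * N = A + Δ := by rw [norm_add_sq_real]; ring
  have hin : |inner ℝ s y| ≤ ‖s‖ * b :=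
    (abs_real_inner_le_norm _ _).trans (by gcongr)
  have hy2 : ‖y‖ ^ 2 ≤ b ^ 2 := by gcongr
  have hΔ2 : Δ ^ 2 * N ≤ 4 * A ^ 2 := by
    have h1 : Δ ^ 2 ≤ 2 * (2 * inner ℝ s y) ^ 2 + 2 * (‖y‖ ^ 2) ^ 2 := by
      nlinarith [sq_nonneg (2 * inner ℝ s y - ‖y‖ ^ 2)]
    have h2 : (inner ℝ s y) ^ 2 ≤ (‖s‖ * b) ^ 2 := by
      rw [← sq_abs]; gcongr
    have h3 : (‖y‖ ^ 2) ^ 2 ≤ (b ^ 2) ^ 2 := by gcongr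
    have h4 : 4 * (‖s‖ ^ 2 * (b ^ 2 * N)) ≤ A ^ 2 := by
      rw [hA]; nlinarith [sq_nonneg (‖s‖ ^ 2 - b ^ 2 * N)]
    have h5 : (b ^ 2) ^ 2 * N ≤ A ^ 2 := by
      have h51 : b ^ 2 * N ≤ A := by rw [hA]; nlinarith [sq_nonneg ‖s‖]
      calc (b ^ 2) ^ 2 * N ≤ (b ^ 2) ^ 2 * N ^ 2 := by gcongr; nlinarith
        _ = (b ^ 2 * N) ^ 2 := by ring
        _ ≤ A ^ 2 := by gcongr
    calc Δ ^ 2 * N ≤ (8 * (‖s‖ * b) ^ 2 + 2 * (b ^ 2) ^ 2) * N := by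
          gcongr; linarith
      _ = 2 * (4 * (‖s‖ ^ 2 * (b ^ 2 * N))) + 2 * ((b ^ 2) ^ 2 * N) := by ring
      _ ≤ _ := by linarith
  set x := Δ / A with hx
  have hx2 : x ^ 2 ≤ 4 / N := by
    rw [hx, div_pow, div_le_div_iff₀ (by positivity) hN0]
    linarith
  have hx3 : x ≤ 3 := by
    have : x ^ 2 ≤ 4 := hx2.trans (by rw [div_le_iff₀ hN0]; linarith)
    nlinarith
  have hx1 : -1 ≤ x := by
    rw [hx, le_div_iff₀ hApos]
    have : 0 ≤ A + Δ := hsum ▸ by positivity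
    linarith
  have hAx : A * x = Δ := by rw [hx]; field_simp
  have hfac : A + Δ = A * (1 + x) := by rw [mul_add, hAx, mul_one]
  have hAΔ : A ^ (q + 1) * x = A ^ q * Δ := by rw [pow_succ, mul_assoc, hAx]
  have hAy : A ^ q * ‖y‖ ^ 2 ≤ A ^ (q + 1) / N := by
    rw [le_div_iff₀ hN0, pow_succ, mul_assoc]
    refine mul_le_mul_of_nonneg_left ?_ (by positivity)
    calc ‖y‖ ^ 2 * N ≤ b ^ 2 * N := by gcongr
      _ ≤ A := by rw [hA]; linarith [sq_nonneg ‖s‖]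
  have h1 := mul_le_mul_of_nonneg_left (hCx x hx1 hx3) (by positivity : 0 ≤ A ^ (q + 1))
  have h2 : C * (A ^ (q + 1) * x ^ 2) ≤ C * (A ^ (q + 1) * (4 / N)) := by gcongr
  have h3 : ((q : ℝ) + 1) * (A ^ q * ‖y‖ ^ 2) ≤ (q + 1) * (A ^ (q + 1) / N) := by gcongr
  rw [hsum, hfac, mul_pow]
  refine h1.trans ?_
  have e1 : A ^ (q + 1) * (1 + ((q + 1 : ℕ) : ℝ) * x + C * x ^ 2) = A ^ (q + 1) +
      2 * (q + 1) * (A ^ q * inner ℝ s y) + (q + 1) * (A ^ q * ‖y‖ ^ 2) +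
        C * (A ^ (q + 1) * x ^ 2) := by
    have : A ^ (q + 1) * (1 + ((q + 1 : ℕ) : ℝ) * x + C * x ^ 2) = A ^ (q + 1) +
      (q + 1) * (A ^ (q + 1) * x) + C * (A ^ (q + 1) * x ^ 2) := by push_cast; ring
    rw [this, hAΔ, hΔ]; ring
  have e2 : (1 + ((q + 1) + 4 * C) / N) * A ^ (q + 1) = A ^ (q + 1) +
      (q + 1) * (A ^ (q + 1) / N) + C * (A ^ (q + 1) * (4 / N)) := by ring
  rw [e1, e2]
  linarith

theorem integral_comp_eq_zero_of_indepFun {Ω α β : Type*} [MeasurableSpace Ω] [MeasurableSpace α]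
    [MeasurableSpace β] {P : Measure Ω} [IsProbabilityMeasure P] {U : Ω → α} {V : Ω → β}
    (hU : Measurable U) (hV : Measurable V) (hUV : IndepFun U V P) {f : α × β → ℝ}
    (hf : Measurable f) (hint : Integrable (fun ω => f (U ω, V ω)) P)
    (hzero : ∀ u, ∫ v, f (u, v) ∂(P.map V) = 0) : ∫ ω, f (U ω, V ω) ∂P = 0 := by
  have hUVm : Measurable fun ω => (U ω, V ω) := hU.prodMk hV
  have hmap := hUV.map_prod_eq_prod_map_map hU.aemeasurable hV.aemeasurable
  have := Measure.isProbabilityMeasure_map (μ := P) hU.aemeasurable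
  have := Measure.isProbabilityMeasure_map (μ := P) hV.aemeasurable
  have h1 : ∫ ω, f (U ω, V ω) ∂P = ∫ z, f z ∂(P.map fun ω => (U ω, V ω)) :=
    (integral_map hUVm.aemeasurable hf.aestronglyMeasurable).symm
  have h2 : Integrable f ((P.map U).prod (P.map V)) := by
    rw [← hmap]
    exact (integrable_map_measure hf.aestronglyMeasurable hUVm.aemeasurable).2 hint
  rw [h1, hmap, integral_prod _ h2]
  simp [hzero]

variable {H : Type*} [NormedAddCommGroup H] [InnerProductSpace ℝ H]
    [TopologicalSpace.SeparableSpace H] [MeasurableSpace H] [BorelSpace H]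
    {G : Type*} [NormedAddCommGroup G] [InnerProductSpace ℝ G]
    {Ω : Type*} [MeasurableSpace Ω] {P : Measure Ω} [IsProbabilityMeasure P]
    {μ : Measure H} {X : ℕ → Ω → H}

set_option linter.unusedSectionVars false

theorem stronglyMeasurable_sum_comp {ψ : H → G} (hψ : Continuous ψ)
    (hXmeas : ∀ i, Measurable (X i)) (k : ℕ) :
    StronglyMeasurable fun ω => ∑ i ∈ Finset.range k, ψ (X i ω) :=
  have : SecondCountableTopology H := UniformSpace.secondCountable_of_separable H
  Finset.stronglyMeasurable_fun_sum _ fun i _ =>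
    hψ.stronglyMeasurable.comp_measurable (hXmeas i)

theorem ae_forall_norm_comp_le {ψ : H → G} (hXmeas : ∀ i, Measurable (X i))
    (hXlaw : ∀ i, P.map (X i) = μ) {b : ℝ} (hb : ∀ᵐ y ∂μ, ‖ψ y‖ ≤ b) :
    ∀ᵐ ω ∂P, ∀ i, ‖ψ (X i ω)‖ ≤ b := by
  rw [ae_all_iff]
  intro i
  rw [← hXlaw i] at hb
  exact ae_of_ae_map (hXmeas i).aemeasurable hb

theorem integrable_norm_sum_pow_mul_inner {ψ : H → G} (hψ : Continuous ψ)
    (hXmeas : ∀ i, Measurable (X i)) (hXlaw : ∀ i, P.map (X i) = μ)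
    {b : ℝ} (hb : ∀ᵐ y ∂μ, ‖ψ y‖ ≤ b) (B : ℝ) (q k j : ℕ) :
    Integrable (fun ω => (‖∑ i ∈ Finset.range k, ψ (X i ω)‖ ^ 2 + B) ^ q *
      inner ℝ (∑ i ∈ Finset.range k, ψ (X i ω)) (ψ (X j ω))) P := by
  have : SecondCountableTopology H := UniformSpace.secondCountable_of_separable H
  have hS := stronglyMeasurable_sum_comp hψ hXmeas k
  have hY : StronglyMeasurable fun ω => ψ (X j ω) :=
    hψ.stronglyMeasurable.comp_measurable (hXmeas j)
  refine Integrable.of_bound (((hS.norm.pow 2).add stronglyMeasurable_const).pow q |>.mul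
    (hS.inner hY)).aestronglyMeasurable (((k * b) ^ 2 + |B|) ^ q * ((k * b) * b)) ?_
  filter_upwards [ae_forall_norm_comp_le hXmeas hXlaw hb] with ω hω
  have hb0 : 0 ≤ b := (norm_nonneg _).trans (hω 0)
  have hSn : ‖∑ i ∈ Finset.range k, ψ (X i ω)‖ ≤ k * b := by
    refine (norm_sum_le_of_le _ fun i _ => hω i).trans ?_
    simp
  rw [norm_mul, norm_pow]
  gcongr
  · refine (norm_add_le _ _).trans ?_
    rw [norm_pow, norm_norm, Real.norm_eq_abs]
    gcongr
  · refine (norm_inner_le_norm _ _).trans ?_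
    gcongr
    exact hω j

theorem integrable_norm_sum_pow {ψ : H → G} (hψ : Continuous ψ)
    (hXmeas : ∀ i, Measurable (X i)) (hXlaw : ∀ i, P.map (X i) = μ)
    {b : ℝ} (hb : ∀ᵐ y ∂μ, ‖ψ y‖ ≤ b) (B : ℝ) (q k : ℕ) :
    Integrable (fun ω => (‖∑ i ∈ Finset.range k, ψ (X i ω)‖ ^ 2 + B) ^ q) P := by
  have hS := stronglyMeasurable_sum_comp hψ hXmeas k
  refine Integrable.of_bound
    (((hS.norm.pow 2).add stronglyMeasurable_const).pow q).aestronglyMeasurable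
    (((k * b) ^ 2 + |B|) ^ q) ?_
  filter_upwards [ae_forall_norm_comp_le hXmeas hXlaw hb] with ω hω
  have hSn : ‖∑ i ∈ Finset.range k, ψ (X i ω)‖ ≤ k * b := by
    refine (norm_sum_le_of_le _ fun i _ => hω i).trans ?_
    simp
  rw [norm_pow]
  gcongr
  refine (norm_add_le _ _).trans ?_
  rw [norm_pow, norm_norm, Real.norm_eq_abs]
  gcongr

/-- The partial sum depends only on the first `k` variables, so Fubini integrates the independent
variable `X k` first, against a fixed vector. -/
theorem integral_pow_mul_inner_eq_zero {ψ : H → G} (hψ : Continuous ψ)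
    (hXmeas : ∀ i, Measurable (X i)) (hXindep : iIndepFun X P) (hXlaw : ∀ i, P.map (X i) = μ)
    {b : ℝ} (hb : ∀ᵐ y ∂μ, ‖ψ y‖ ≤ b) (hcent : ∀ s, ∫ y, inner ℝ s (ψ y) ∂μ = 0)
    (B : ℝ) (q k : ℕ) :
    ∫ ω, (‖∑ i ∈ Finset.range k, ψ (X i ω)‖ ^ 2 + B) ^ q *
      inner ℝ (∑ i ∈ Finset.range k, ψ (X i ω)) (ψ (X k ω)) ∂P = 0 := by
  have : SecondCountableTopology H := UniformSpace.secondCountable_of_separable H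
  have hind : IndepFun (fun ω (i : Finset.range k) => X i ω) (X k) P := by
    have h1 := hXindep.indepFun_finset (Finset.range k) {k} (by simp) hXmeas
    exact h1.comp measurable_id (measurable_pi_apply (⟨k, by simp⟩ : ({k} : Finset ℕ)))
  set f : (Finset.range k → H) × H → ℝ := fun p => (‖∑ i, ψ (p.1 i)‖ ^ 2 + B) ^ q *
      inner ℝ (∑ i, ψ (p.1 i)) (ψ p.2) with hf
  have hfc : Continuous f := by fun_prop
  have hsum : ∀ ω, ∑ i : Finset.range k, ψ (X i ω) = ∑ i ∈ Finset.range k, ψ (X i ω) := fun ω =>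
    Finset.sum_coe_sort (Finset.range k) fun i => ψ (X i ω)
  have h0 := integral_comp_eq_zero_of_indepFun (P := P) (f := f)
    (U := fun ω (i : Finset.range k) => X i ω)
    (measurable_pi_lambda _ fun i => hXmeas i) (hXmeas k) hind hfc.measurable
  simp only [hf, hsum] at h0
  refine h0 (integrable_norm_sum_pow_mul_inner hψ hXmeas hXlaw hb B q k k) fun u => ?_
  rw [hXlaw, integral_const_mul, hcent, mul_zero]

/-- Even moments of sums of i.i.d. bounded centered random elements of a Hilbert space. -/
theorem integral_norm_sum_pow_le (q : ℕ) {ψ : H → G} (hψ : Continuous ψ)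
    (hXmeas : ∀ i, Measurable (X i)) (hXindep : iIndepFun X P) (hXlaw : ∀ i, P.map (X i) = μ)
    {b : ℝ} (hb0 : 0 < b) (hb : ∀ᵐ y ∂μ, ‖ψ y‖ ≤ b)
    (hcent : ∀ s, ∫ y, inner ℝ s (ψ y) ∂μ = 0) :
    ∃ C : ℝ, 0 ≤ C ∧ ∀ n : ℕ,
      ∫ ω, ‖∑ i ∈ Finset.range n, ψ (X i ω)‖ ^ (2 * (q + 1)) ∂P ≤ C * (n : ℝ) ^ (q + 1) := by
  obtain ⟨c, hc, hstep⟩ := norm_add_sq_add_pow_le.{_} q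
  refine ⟨Real.exp c * (b ^ 2) ^ (q + 1), by positivity, fun n => ?_⟩
  rcases Nat.eq_zero_or_pos n with rfl | hn
  · simp
  set N : ℝ := (n : ℝ) with hN
  have hN1 : 1 ≤ N := by rw [hN]; exact_mod_cast hn
  -- The shift stays at the final sample size `N = n` throughout, so the `n` factors `1 + c / N`
  -- multiply to at most `exp c`.
  have key : ∀ k : ℕ, ∫ ω, (‖∑ i ∈ Finset.range k, ψ (X i ω)‖ ^ 2 + b ^ 2 * N) ^ (q + 1) ∂P ≤
      (1 + c / N) ^ k * (b ^ 2 * N) ^ (q + 1) := by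
    intro k
    induction k with
    | zero => simp
    | succ k ih =>
      have hi1 := integrable_norm_sum_pow hψ hXmeas hXlaw hb (b ^ 2 * N) (q + 1) k
      have hi2 := integrable_norm_sum_pow_mul_inner hψ hXmeas hXlaw hb (b ^ 2 * N) q k k
      calc ∫ ω, (‖∑ i ∈ Finset.range (k + 1), ψ (X i ω)‖ ^ 2 + b ^ 2 * N) ^ (q + 1) ∂P
          ≤ ∫ ω, ((1 + c / N) * (‖∑ i ∈ Finset.range k, ψ (X i ω)‖ ^ 2 + b ^ 2 * N) ^ (q + 1) +
            2 * (q + 1) * ((‖∑ i ∈ Finset.range k, ψ (X i ω)‖ ^ 2 + b ^ 2 * N) ^ q *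
              inner ℝ (∑ i ∈ Finset.range k, ψ (X i ω)) (ψ (X k ω)))) ∂P := by
            refine integral_mono_ae (integrable_norm_sum_pow hψ hXmeas hXlaw hb _ _ _)
              ((hi1.const_mul _).add (hi2.const_mul _)) ?_
            filter_upwards [ae_forall_norm_comp_le hXmeas hXlaw hb] with ω hω
            simp only [Finset.sum_range_succ]
            exact hstep b N _ _ hb0 hN1 (hω k)
        _ = (1 + c / N) *
            ∫ ω, (‖∑ i ∈ Finset.range k, ψ (X i ω)‖ ^ 2 + b ^ 2 * N) ^ (q + 1) ∂P := by
            rw [integral_add (hi1.const_mul _) (hi2.const_mul _), integral_const_mul,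
              integral_const_mul,
              integral_pow_mul_inner_eq_zero hψ hXmeas hXindep hXlaw hb hcent, mul_zero, add_zero]
        _ ≤ (1 + c / N) * ((1 + c / N) ^ k * (b ^ 2 * N) ^ (q + 1)) := by gcongr
        _ = _ := by ring
  have hexp : (1 + c / N) ^ n ≤ Real.exp c := by
    calc (1 + c / N) ^ n ≤ Real.exp (c / N) ^ n := by
          gcongr
          linarith [Real.add_one_le_exp (c / N)]
      _ = Real.exp c := by
          rw [← Real.exp_nat_mul]; congr 1; rw [← hN]; field_simp
  calc ∫ ω, ‖∑ i ∈ Finset.range n, ψ (X i ω)‖ ^ (2 * (q + 1)) ∂P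
      ≤ ∫ ω, (‖∑ i ∈ Finset.range n, ψ (X i ω)‖ ^ 2 + b ^ 2 * N) ^ (q + 1) ∂P := by
        refine integral_mono ?_ (integrable_norm_sum_pow hψ hXmeas hXlaw hb _ _ _) fun ω => ?_
        · have := integrable_norm_sum_pow hψ hXmeas hXlaw hb 0 (q + 1) n
          simpa only [add_zero, ← pow_mul] using this
        · simp only [pow_mul]
          gcongr
          have : 0 ≤ b ^ 2 * N := by positivity
          linarith
    _ ≤ (1 + c / N) ^ n * (b ^ 2 * N) ^ (q + 1) := key n
    _ ≤ Real.exp c * (b ^ 2 * N) ^ (q + 1) := by gcongr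
    _ = _ := by ring

end Moments

/-! ### Covariance operators and their deviation in the tensor square. -/

section Covariance

set_option linter.unusedSectionVars false

open scoped TensorProduct

variable {H : Type*} [NormedAddCommGroup H] [InnerProductSpace ℝ H]

/-- The operator `v ↦ ⟨x, v⟩ x`. -/
noncomputable def rankOneOp (x : H) : H →L[ℝ] H :=
  (innerSL ℝ x).smulRight x

theorem rankOneOp_apply (x v : H) : rankOneOp x v = inner ℝ x v • x := rfl

theorem isCompactOperator_rankOneOp (x : H) : IsCompactOperator (rankOneOp x) := by
  have h : IsCompactOperator (id : ℝ → ℝ) := isCompactOperator_id_iff_locallyCompactSpace.2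
    inferInstance
  exact (h.comp_clm (innerSL ℝ x)).clm_comp (ContinuousLinearMap.toSpanSingleton ℝ x)

theorem continuous_rankOneOp : Continuous (rankOneOp : H → H →L[ℝ] H) := by
  unfold rankOneOp
  exact ((ContinuousLinearMap.smulRightL ℝ H H).continuous₂).comp
    ((innerSL ℝ).continuous.prodMk continuous_id)

theorem norm_rankOneOp_le (x : H) : ‖rankOneOp x‖ ≤ ‖x‖ ^ 2 := by
  refine ContinuousLinearMap.opNorm_le_bound _ (by positivity) fun v => ?_
  rw [rankOneOp_apply, norm_smul]
  have := norm_inner_le_norm (𝕜 := ℝ) x v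
  nlinarith [norm_nonneg x]

theorem inner_rankOneOp (x v w : H) :
    inner ℝ (rankOneOp x v) w = inner ℝ x v * inner ℝ x w := by
  rw [rankOneOp_apply, inner_smul_left, conj_trivial]

/-- The empirical covariance operator as a continuous linear map. -/
noncomputable def empCovCLM (x : ℕ → H) (n : ℕ) : H →L[ℝ] H :=
  (n : ℝ)⁻¹ • ∑ i ∈ Finset.range n, rankOneOp (x i)

theorem coe_empCovCLM (x : ℕ → H) (n : ℕ) : ⇑(empCovCLM x n) = empCovOp x n := by
  funext v
  simp [empCovCLM, empCovOp, rankOneOp_apply]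

theorem inner_empCovCLM (x : ℕ → H) (n : ℕ) (v w : H) :
    inner ℝ (empCovCLM x n v) w =
      (n : ℝ)⁻¹ * ∑ i ∈ Finset.range n, inner ℝ (x i) v * inner ℝ (x i) w := by
  simp [empCovCLM, inner_smul_left, sum_inner, inner_rankOneOp]

theorem isCompactOperator_empCovCLM (x : ℕ → H) (n : ℕ) :
    IsCompactOperator (empCovCLM x n) := by
  have h : empCovCLM x n ∈ compactOperator (RingHom.id ℝ) H H :=
    Submodule.smul_mem _ _ (Submodule.sum_mem _ fun i _ => isCompactOperator_rankOneOp (x i))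
  exact h

theorem empCovCLM_symm (x : ℕ → H) (n : ℕ) (v w : H) :
    inner ℝ (empCovCLM x n v) w = inner ℝ v (empCovCLM x n w) := by
  rw [real_inner_comm _ v, inner_empCovCLM, inner_empCovCLM]
  simp only [mul_comm]

theorem empCovCLM_nonneg (x : ℕ → H) (n : ℕ) (v : H) : 0 ≤ inner ℝ (empCovCLM x n v) v := by
  rw [inner_empCovCLM]
  exact mul_nonneg (by positivity) (Finset.sum_nonneg fun i _ => mul_self_nonneg _)

variable [MeasurableSpace H]

/-- The covariance operator as a continuous linear map. -/
noncomputable def covCLM (μ : Measure H) : H →L[ℝ] H := ∫ x, rankOneOp x ∂μ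

variable [CompleteSpace H] [TopologicalSpace.SeparableSpace H] [BorelSpace H]
  {μ : Measure H} [IsProbabilityMeasure μ] {R : ℝ}

theorem integrable_rankOneOp (hR : ∀ᵐ y ∂μ, ‖y‖ ≤ R) :
    Integrable (rankOneOp : H → H →L[ℝ] H) μ := by
  have : SecondCountableTopology H := UniformSpace.secondCountable_of_separable H
  refine Integrable.of_bound continuous_rankOneOp.aestronglyMeasurable (R ^ 2) ?_
  filter_upwards [hR] with y hy
  exact (norm_rankOneOp_le y).trans (by gcongr)

theorem coe_covCLM (hR : ∀ᵐ y ∂μ, ‖y‖ ≤ R) : ⇑(covCLM μ) = covOp μ := by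
  funext v
  rw [covCLM, ContinuousLinearMap.integral_apply (integrable_rankOneOp hR)]
  rfl

theorem inner_covCLM (hR : ∀ᵐ y ∂μ, ‖y‖ ≤ R) (v w : H) :
    inner ℝ (covCLM μ v) w = ∫ x, inner ℝ x v * inner ℝ x w ∂μ := by
  have hint : Integrable (fun x => rankOneOp x v) μ :=
    (integrable_rankOneOp hR).apply_continuousLinearMap v
  rw [covCLM, ContinuousLinearMap.integral_apply (integrable_rankOneOp hR), real_inner_comm,
    ← integral_inner hint]
  refine integral_congr_ae (Eventually.of_forall fun x => ?_)
  exact (real_inner_comm _ _).trans (inner_rankOneOp x v w)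

/-- Compact operators form a closed convex set, which therefore contains the mean of the rank-one
operators. -/
theorem isCompactOperator_covCLM (hR : ∀ᵐ y ∂μ, ‖y‖ ≤ R) : IsCompactOperator (covCLM μ) := by
  have h : covCLM μ ∈ (compactOperator (RingHom.id ℝ) H H : Set (H →L[ℝ] H)) :=
    (compactOperator (RingHom.id ℝ) H H).convex.integral_mem isClosed_setOfPred_isCompactOperator
      (Eventually.of_forall fun x => isCompactOperator_rankOneOp x) (integrable_rankOneOp hR)
  exact h

theorem covCLM_symm (hR : ∀ᵐ y ∂μ, ‖y‖ ≤ R) (v w : H) :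
    inner ℝ (covCLM μ v) w = inner ℝ v (covCLM μ w) := by
  rw [real_inner_comm _ v, inner_covCLM hR, inner_covCLM hR]
  simp only [mul_comm]

theorem covCLM_nonneg (hR : ∀ᵐ y ∂μ, ‖y‖ ≤ R) (v : H) : 0 ≤ inner ℝ (covCLM μ v) v := by
  rw [inner_covCLM hR]
  exact integral_nonneg fun x => mul_self_nonneg _

variable (H) in
/-- The Hilbert tensor square of `H`. -/
abbrev TensorSquare : Type _ := UniformSpace.Completion (H ⊗[ℝ] H)

/-- The embedding `x ↦ x ⊗ x` into the Hilbert tensor square. -/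
noncomputable def tensorDiag (x : H) : TensorSquare H := ((x ⊗ₜ[ℝ] x : H ⊗[ℝ] H) : TensorSquare H)

theorem continuous_tensorDiag : Continuous (tensorDiag : H → TensorSquare H) :=
  (UniformSpace.Completion.continuous_coe _).comp
    (TensorProduct.continuous_tmul.comp (continuous_id.prodMk continuous_id))

theorem norm_tensorDiag (x : H) : ‖tensorDiag x‖ = ‖x‖ ^ 2 := by
  rw [tensorDiag, UniformSpace.Completion.norm_coe, TensorProduct.norm_tmul, pow_two]

theorem inner_tensorDiag (x v w : H) :
    inner ℝ (tensorDiag x) ((v ⊗ₜ[ℝ] w : H ⊗[ℝ] H) : TensorSquare H) =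
      inner ℝ x v * inner ℝ x w := by
  rw [tensorDiag, UniformSpace.Completion.inner_coe, TensorProduct.inner_tmul]

/-- The centered embedding into the Hilbert tensor square. -/
noncomputable def centeredTensor (μ : Measure H) (x : H) : TensorSquare H :=
  tensorDiag x - ∫ y, tensorDiag y ∂μ

theorem integrable_tensorDiag (hR : ∀ᵐ y ∂μ, ‖y‖ ≤ R) :
    Integrable (tensorDiag : H → TensorSquare H) μ := by
  have : SecondCountableTopology H := UniformSpace.secondCountable_of_separable H
  refine Integrable.of_bound continuous_tensorDiag.aestronglyMeasurable (R ^ 2) ?_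
  filter_upwards [hR] with y hy
  rw [norm_tensorDiag]
  gcongr

theorem integral_inner_centeredTensor (hR : ∀ᵐ y ∂μ, ‖y‖ ≤ R) (s : TensorSquare H) :
    ∫ x, inner ℝ s (centeredTensor μ x) ∂μ = 0 := by
  have hi := integrable_tensorDiag hR
  have hint : Integrable (centeredTensor μ) μ := hi.sub (integrable_const _)
  rw [integral_inner hint]
  simp only [centeredTensor]
  rw [integral_sub hi (integrable_const _)]
  simp

theorem inner_centeredTensor (hR : ∀ᵐ y ∂μ, ‖y‖ ≤ R) (x v w : H) :
    inner ℝ (centeredTensor μ x) ((v ⊗ₜ[ℝ] w : H ⊗[ℝ] H) : TensorSquare H) =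
      inner ℝ x v * inner ℝ x w - inner ℝ (covCLM μ v) w := by
  rw [centeredTensor, inner_sub_left, inner_tensorDiag, inner_covCLM hR]
  congr 1
  rw [real_inner_comm, ← integral_inner (integrable_tensorDiag hR)]
  refine integral_congr_ae (Eventually.of_forall fun y => ?_)
  exact (real_inner_comm _ _).trans (inner_tensorDiag y v w)

/-- Duality: with `d` the difference applied to `v`, `‖d‖²` is the pairing of the averaged tensor
with `v ⊗ d`. This replaces the operator norm by a Hilbert norm, to which the moment bound applies.
-/
theorem norm_empCovCLM_sub_covCLM_le (hR : ∀ᵐ y ∂μ, ‖y‖ ≤ R) (x : ℕ → H) {n : ℕ} (hn : n ≠ 0)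
    (v : H) : ‖empCovCLM x n v - covCLM μ v‖ ≤
      ‖(n : ℝ)⁻¹ • ∑ i ∈ Finset.range n, centeredTensor μ (x i)‖ * ‖v‖ := by
  set d := empCovCLM x n v - covCLM μ v with hd
  set Z := (n : ℝ)⁻¹ • ∑ i ∈ Finset.range n, centeredTensor μ (x i) with hZ
  have h1 : ‖d‖ ^ 2 = inner ℝ Z ((v ⊗ₜ[ℝ] d : H ⊗[ℝ] H) : TensorSquare H) := by
    rw [← real_inner_self_eq_norm_sq, hZ, inner_smul_left, sum_inner]
    simp only [inner_centeredTensor hR]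
    conv_lhs => rw [hd, inner_sub_left, ← hd, inner_empCovCLM]
    rw [Finset.sum_sub_distrib, mul_sub, conj_trivial]
    simp only [Finset.sum_const, Finset.card_range, nsmul_eq_mul]
    rw [inv_mul_cancel_left₀ (Nat.cast_ne_zero.2 hn)]
  have h2 : ‖d‖ ^ 2 ≤ ‖Z‖ * (‖v‖ * ‖d‖) := by
    rw [h1]
    refine (real_inner_le_norm _ _).trans ?_
    rw [UniformSpace.Completion.norm_coe, TensorProduct.norm_tmul]
  rcases (norm_nonneg d).eq_or_lt with h0 | h0
  · rw [← h0]; positivity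
  · refine le_of_mul_le_mul_right ?_ h0
    nlinarith

variable {Ω : Type*} [MeasurableSpace Ω] {P : Measure Ω} [IsProbabilityMeasure P]
  {X : ℕ → Ω → H}

/-- Polynomial deviation bound for the empirical covariance operator. -/
theorem exists_covariance_deviation (hR : ∀ᵐ y ∂μ, ‖y‖ ≤ R) (hXmeas : ∀ i, Measurable (X i))
    (hXindep : iIndepFun X P) (hXlaw : ∀ i, P.map (X i) = μ) (q : ℕ) :
    ∃ dev : ℕ → Ω → ℝ, (∀ n, Measurable (dev n)) ∧ (∀ n ω, 0 ≤ dev n ω) ∧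
      (∀ n ω v, n ≠ 0 →
        ‖empCovCLM (fun i => X i ω) n v - covCLM μ v‖ ≤ dev n ω * ‖v‖) ∧
      ∃ C, 0 ≤ C ∧ ∀ (n : ℕ) (t : ℝ), n ≠ 0 → 0 < t →
        P.real {ω | t ≤ dev n ω} ≤ C / (n * t ^ 2) ^ (q + 1) := by
  have hψ : Continuous (centeredTensor μ) := continuous_tensorDiag.sub continuous_const
  set b := R ^ 2 + ‖∫ y, tensorDiag y ∂μ‖ + 1 with hb
  have hb0 : 0 < b := by positivity
  have hbound : ∀ᵐ y ∂μ, ‖centeredTensor μ y‖ ≤ b := by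
    filter_upwards [hR] with y hy
    refine (norm_sub_le _ _).trans ?_
    rw [norm_tensorDiag]
    have : ‖y‖ ^ 2 ≤ R ^ 2 := by gcongr
    linarith
  obtain ⟨C, hC, hmom⟩ := integral_norm_sum_pow_le q hψ hXmeas hXindep hXlaw hb0 hbound
    (integral_inner_centeredTensor hR)
  refine ⟨fun n ω => ‖(n : ℝ)⁻¹ • ∑ i ∈ Finset.range n, centeredTensor μ (X i ω)‖,
    fun n => ((stronglyMeasurable_sum_comp hψ hXmeas n).const_smul (n : ℝ)⁻¹).norm.measurable,
    fun n ω => norm_nonneg _,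
    fun n ω v hn => norm_empCovCLM_sub_covCLM_le hR (fun i => X i ω) hn v, C, hC,
    fun n t hn ht => ?_⟩
  have hn0 : (0 : ℝ) < n := by exact_mod_cast Nat.pos_of_ne_zero hn
  have hint : Integrable
      (fun ω => ‖∑ i ∈ Finset.range n, centeredTensor μ (X i ω)‖ ^ (2 * (q + 1))) P := by
    have := integrable_norm_sum_pow hψ hXmeas hXlaw hbound 0 (q + 1) n
    simpa only [add_zero, ← pow_mul] using this
  have hmarkov := mul_meas_ge_le_integral_of_nonneg
    (Eventually.of_forall fun ω => by positivity) hint ((n * t) ^ (2 * (q + 1)))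
  have hset : {ω | t ≤ ‖(n : ℝ)⁻¹ • ∑ i ∈ Finset.range n, centeredTensor μ (X i ω)‖} ⊆
      {ω | (n * t) ^ (2 * (q + 1)) ≤
        ‖∑ i ∈ Finset.range n, centeredTensor μ (X i ω)‖ ^ (2 * (q + 1))} := by
    intro ω hω
    simp only [Set.mem_ofPred_eq, norm_smul, norm_inv, Real.norm_natCast] at hω ⊢
    gcongr
    rwa [le_inv_mul_iff₀ hn0] at hω
  have h1 : P.real {ω | t ≤ ‖(n : ℝ)⁻¹ • ∑ i ∈ Finset.range n, centeredTensor μ (X i ω)‖} ≤ _ :=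
    measureReal_mono hset
  refine h1.trans ?_
  rw [le_div_iff₀ (by positivity)]
  have h2 := hmarkov.trans (hmom n)
  have e1 : ((n : ℝ) * t) ^ (2 * (q + 1)) = (n * t ^ 2) ^ (q + 1) * n ^ (q + 1) := by
    rw [pow_mul, ← mul_pow]; congr 1; ring
  rw [e1] at h2 ⊢
  generalize P.real _ = p at h2 ⊢
  refine le_of_mul_le_mul_right ?_ (by positivity : (0 : ℝ) < n ^ (q + 1))
  linarith

end Covariance

/-! ### Concentration of the number of sample points in a set. -/

section Counting

set_option linter.unusedSectionVars false

theorem ae_eventually_notMem_of_le_inv_sq {Ω : Type*} [MeasurableSpace Ω] {P : Measure Ω}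
    [IsProbabilityMeasure P] {s : ℕ → Set Ω} {C : ℝ}
    (hs : ∀ᶠ n : ℕ in atTop, P.real (s n) ≤ C * ((n : ℝ) ^ 2)⁻¹) :
    ∀ᵐ ω ∂P, ∀ᶠ n in atTop, ω ∉ s n := by
  refine ae_eventually_notMem ?_
  have h1 : Summable fun n : ℕ => C * ((n : ℝ) ^ 2)⁻¹ :=
    (Real.summable_nat_pow_inv.2 one_lt_two).mul_left C
  have h2 : Summable fun n => P.real (s n) := by
    refine Summable.of_norm_bounded_eventually_nat h1 ?_
    filter_upwards [hs] with n hn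
    rwa [Real.norm_of_nonneg measureReal_nonneg]
  have h3 := h2.tsum_ofReal_ne_top
  simpa [ofReal_measureReal, measure_ne_top] using h3

variable {E : Type*}

/-- The number of the first `n` terms of a sequence that lie in a set. -/
noncomputable def count (B : Set E) (x : ℕ → E) (n : ℕ) : ℝ :=
  ∑ i ∈ Finset.range n, B.indicator (fun _ => (1 : ℝ)) (x i)

theorem count_nonneg (B : Set E) (x : ℕ → E) (n : ℕ) : 0 ≤ count B x n :=
  Finset.sum_nonneg fun _ _ => Set.indicator_nonneg (fun _ _ => zero_le_one) _

theorem count_le (B : Set E) (x : ℕ → E) (n : ℕ) : count B x n ≤ n := by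
  calc count B x n ≤ ∑ _i ∈ Finset.range n, (1 : ℝ) :=
        Finset.sum_le_sum fun i _ => Set.indicator_le_self' (fun _ _ => zero_le_one) _
    _ = n := by simp

variable {Ω : Type*} [MeasurableSpace Ω] {P : Measure Ω} [IsProbabilityMeasure P]
  [MeasurableSpace E] {μ : Measure E} {X : ℕ → Ω → E} {B : Set E}

theorem measurable_indicator_comp (hXmeas : ∀ i, Measurable (X i)) (hB : MeasurableSet B) (i : ℕ) :
    Measurable fun ω => B.indicator (fun _ => (1 : ℝ)) (X i ω) :=
  (measurable_const.indicator hB).comp (hXmeas i)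

theorem measurable_count (hXmeas : ∀ i, Measurable (X i)) (hB : MeasurableSet B) (n : ℕ) :
    Measurable fun ω => count B (fun i => X i ω) n :=
  Finset.measurable_fun_sum _ fun i _ => measurable_indicator_comp hXmeas hB i

theorem memLp_indicator_comp (hXmeas : ∀ i, Measurable (X i)) (hB : MeasurableSet B) (i : ℕ)
    (p : ENNReal) : MemLp (fun ω => B.indicator (fun _ => (1 : ℝ)) (X i ω)) p P := by
  refine MemLp.of_bound (measurable_indicator_comp hXmeas hB i).aestronglyMeasurable 1 ?_
  refine Eventually.of_forall fun ω => ?_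
  by_cases h : X i ω ∈ B <;> simp [h]

theorem integrable_count_pow (hXmeas : ∀ i, Measurable (X i)) (hB : MeasurableSet B) (n k : ℕ) :
    Integrable (fun ω => count B (fun i => X i ω) n ^ k) P := by
  refine Integrable.of_bound ((measurable_count hXmeas hB n).pow_const k).aestronglyMeasurable
    ((n : ℝ) ^ k) (Eventually.of_forall fun ω => ?_)
  rw [Real.norm_of_nonneg (pow_nonneg (count_nonneg _ _ _) _)]
  exact pow_le_pow_left₀ (count_nonneg _ _ _) (count_le _ _ _) _

theorem integral_indicator_comp (hXmeas : ∀ i, Measurable (X i)) (hXlaw : ∀ i, P.map (X i) = μ)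
    (hB : MeasurableSet B) (i : ℕ) :
    ∫ ω, B.indicator (fun _ => (1 : ℝ)) (X i ω) ∂P = μ.real B := by
  have h1 : ∫ x, B.indicator (fun _ => (1 : ℝ)) x ∂μ = μ.real B := integral_indicator_one hB
  rw [← h1, ← hXlaw i, integral_map (hXmeas i).aemeasurable
      (measurable_const.indicator hB).aestronglyMeasurable]

theorem integral_count (hXmeas : ∀ i, Measurable (X i)) (hXlaw : ∀ i, P.map (X i) = μ)
    (hB : MeasurableSet B) (n : ℕ) :
    ∫ ω, count B (fun i => X i ω) n ∂P = n * μ.real B := by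
  unfold count
  rw [integral_finsetSum _ fun i _ =>
    (memLp_indicator_comp hXmeas hB i 1).integrable le_rfl]
  simp [integral_indicator_comp hXmeas hXlaw hB]

theorem iIndepFun_indicator_comp (hXindep : iIndepFun X P) (hB : MeasurableSet B) :
    iIndepFun (fun i ω => B.indicator (fun _ => (1 : ℝ)) (X i ω)) P :=
  hXindep.comp (fun _ => B.indicator fun _ => (1 : ℝ)) fun _ => measurable_const.indicator hB

/-- The variance of a sum of independent indicators is at most its mean. -/
theorem integral_count_sq_le (hXmeas : ∀ i, Measurable (X i)) (hXindep : iIndepFun X P)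
    (hXlaw : ∀ i, P.map (X i) = μ) (hB : MeasurableSet B) (n : ℕ) :
    ∫ ω, count B (fun i => X i ω) n ^ 2 ∂P ≤ n * μ.real B + (n * μ.real B) ^ 2 := by
  have hind := iIndepFun_indicator_comp hXindep hB
  have hvar : variance (fun ω => count B (fun i => X i ω) n) P ≤ n * μ.real B := by
    have h1 : (fun ω => count B (fun i => X i ω) n) =
        ∑ i ∈ Finset.range n, fun ω => B.indicator (fun _ => (1 : ℝ)) (X i ω) := by
      funext ω; simp [count]
    rw [h1, IndepFun.variance_sum (fun i _ => memLp_indicator_comp hXmeas hB i 2)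
      fun i _ j _ hij => hind.indepFun hij]
    calc _ ≤ ∑ _i ∈ Finset.range n, μ.real B := by
          refine Finset.sum_le_sum fun i _ => ?_
          refine (variance_le_expectation_sq
            (measurable_indicator_comp hXmeas hB i).aestronglyMeasurable).trans ?_
          rw [← integral_indicator_comp hXmeas hXlaw hB i]
          refine le_of_eq (integral_congr_ae (Eventually.of_forall fun ω => ?_))
          by_cases h : X i ω ∈ B <;> simp [h]
      _ = _ := by simp
  have hmem : MemLp (fun ω => count B (fun i => X i ω) n) 2 P := by
    refine MemLp.of_bound (measurable_count hXmeas hB n).aestronglyMeasurable n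
      (Eventually.of_forall fun ω => ?_)
    rw [Real.norm_of_nonneg (count_nonneg _ _ _)]
    exact count_le _ _ _
  rw [variance_eq_sub hmem, integral_count hXmeas hXlaw hB] at hvar
  simp only [Pi.pow_apply] at hvar
  linarith

theorem mgf_count_le (hXmeas : ∀ i, Measurable (X i)) (hXindep : iIndepFun X P)
    (hXlaw : ∀ i, P.map (X i) = μ) (hB : MeasurableSet B) (n : ℕ) (t : ℝ) :
    mgf (fun ω => count B (fun i => X i ω) n) P t ≤
      Real.exp (n * μ.real B * (Real.exp t - 1)) := by
  have h1 : (fun ω => count B (fun i => X i ω) n) =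
      ∑ i ∈ Finset.range n, fun ω => B.indicator (fun _ => (1 : ℝ)) (X i ω) := by
    funext ω; simp [count]
  rw [h1, (iIndepFun_indicator_comp hXindep hB).mgf_sum
    fun i => measurable_indicator_comp hXmeas hB i]
  have h2 : ∀ i, mgf (fun ω => B.indicator (fun _ => (1 : ℝ)) (X i ω)) P t ≤
      Real.exp (μ.real B * (Real.exp t - 1)) := fun i => by
    have h3 : ∀ ω, Real.exp (t * B.indicator (fun _ => (1 : ℝ)) (X i ω)) =
        1 + B.indicator (fun _ => (1 : ℝ)) (X i ω) * (Real.exp t - 1) := fun ω => by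
      by_cases h : X i ω ∈ B <;> simp [h]
    unfold mgf
    simp only [h3]
    rw [integral_add (integrable_const _)
      (((memLp_indicator_comp hXmeas hB i 1).integrable le_rfl).mul_const _),
      integral_mul_const, integral_indicator_comp hXmeas hXlaw hB]
    simp only [integral_const, probReal_univ, one_smul]
    linarith [Real.add_one_le_exp (μ.real B * (Real.exp t - 1))]
  calc _ ≤ ∏ _i ∈ Finset.range n, Real.exp (μ.real B * (Real.exp t - 1)) :=
        Finset.prod_le_prod (fun i _ => mgf_nonneg) fun i _ => h2 i
    _ = _ := by rw [Finset.prod_const, Finset.card_range, ← Real.exp_nat_mul, mul_assoc]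

/-- Chernoff bound for the number of sample points in a set. -/
theorem measureReal_le_abs_count_sub (hXmeas : ∀ i, Measurable (X i)) (hXindep : iIndepFun X P)
    (hXlaw : ∀ i, P.map (X i) = μ) (hB : MeasurableSet B) (n : ℕ) {ε : ℝ} (hε0 : 0 < ε)
    (hε1 : ε ≤ 1) :
    P.real {ω | ε * (n * μ.real B) ≤ |count B (fun i => X i ω) n - n * μ.real B|} ≤
      2 * Real.exp (-(ε ^ 2 / 4) * (n * μ.real B)) := by
  set m : ℝ := n * μ.real B with hm
  have hm0 : 0 ≤ m := by positivity
  have hint : ∀ t : ℝ, Integrable (fun ω => Real.exp (t * count B (fun i => X i ω) n)) P := by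
    intro t
    refine Integrable.of_bound
      ((measurable_count hXmeas hB n).const_mul t).exp.aestronglyMeasurable
      (Real.exp (|t| * n)) (Eventually.of_forall fun ω => ?_)
    rw [Real.norm_of_nonneg (Real.exp_nonneg _), Real.exp_le_exp]
    refine (le_abs_self _).trans ?_
    rw [abs_mul, abs_of_nonneg (count_nonneg _ _ _)]
    exact mul_le_mul_of_nonneg_left (count_le _ _ _) (abs_nonneg _)
  have hexp : ∀ t : ℝ, |t| ≤ 1 → m * (Real.exp t - 1) ≤ m * (t + t ^ 2) := fun t ht => by
    refine mul_le_mul_of_nonneg_left ?_ hm0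
    have := (abs_le.1 (Real.abs_exp_sub_one_sub_id_le ht)).2
    linarith
  have hup : P.real {ω | (1 + ε) * m ≤ count B (fun i => X i ω) n} ≤
      Real.exp (-(ε ^ 2 / 4) * m) := by
    -- `t = ε / 2` minimizes the exponent `m (t + t²) - t (1 + ε) m`, with value `-ε² m / 4`.
    refine (measure_ge_le_exp_mul_mgf (t := ε / 2) _ (by positivity) (hint _)).trans ?_
    refine (mul_le_mul_of_nonneg_left (mgf_count_le hXmeas hXindep hXlaw hB n (ε / 2))
      (Real.exp_nonneg _)).trans ?_
    rw [← Real.exp_add, Real.exp_le_exp, ← hm]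
    have := hexp (ε / 2) (by rw [abs_of_pos (by positivity)]; linarith)
    nlinarith
  have hlow : P.real {ω | count B (fun i => X i ω) n ≤ (1 - ε) * m} ≤
      Real.exp (-(ε ^ 2 / 4) * m) := by
    refine (measure_le_le_exp_mul_mgf (t := -(ε / 2)) _ (by linarith) (hint _)).trans ?_
    refine (mul_le_mul_of_nonneg_left (mgf_count_le hXmeas hXindep hXlaw hB n (-(ε / 2)))
      (Real.exp_nonneg _)).trans ?_
    rw [← Real.exp_add, Real.exp_le_exp, ← hm]
    have := hexp (-(ε / 2)) (by rw [abs_neg, abs_of_pos (by positivity)]; linarith)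
    nlinarith
  have hsub : {ω | ε * m ≤ |count B (fun i => X i ω) n - m|} ⊆
      {ω | (1 + ε) * m ≤ count B (fun i => X i ω) n} ∪
        {ω | count B (fun i => X i ω) n ≤ (1 - ε) * m} := by
    intro ω hω
    simp only [Set.mem_ofPred_eq, Set.mem_union] at hω ⊢
    rcases le_abs.1 hω with h | h
    · left; linarith
    · right; linarith
  calc _ ≤ _ := measureReal_mono hsub
    _ ≤ _ := measureReal_union_le _ _
    _ ≤ _ := by linarith

theorem ae_tendsto_count_div (hXmeas : ∀ i, Measurable (X i)) (hXindep : iIndepFun X P)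
    (hXlaw : ∀ i, P.map (X i) = μ) {B : ℕ → Set E} (hB : ∀ n, MeasurableSet (B n))
    (hlog : Tendsto (fun n : ℕ => n * μ.real (B n) / Real.log n) atTop atTop) :
    ∀ᵐ ω ∂P, Tendsto (fun n => count (B n) (fun i => X i ω) n / (n * μ.real (B n))) atTop
      (𝓝 1) := by
  have hmain : ∀ k : ℕ, ∀ᵐ ω ∂P, ∀ᶠ n : ℕ in atTop,
      ω ∉ {ω | ((k : ℝ) + 1)⁻¹ * (n * μ.real (B n)) ≤
        |count (B n) (fun i => X i ω) n - n * μ.real (B n)|} := by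
    intro k
    refine ae_eventually_notMem_of_le_inv_sq (C := 2) ?_
    have hε1 : ((k : ℝ) + 1)⁻¹ ≤ 1 := inv_le_one_of_one_le₀ (by linarith [Nat.cast_nonneg (α := ℝ) k])
    -- With `ε = 1 / (k + 1)`, the factor `8 (k + 1)²` makes the Chernoff exponent at most `-2 log
    -- n`, hence a summable bound.
    filter_upwards [hlog.eventually_ge_atTop (8 * ((k : ℝ) + 1) ^ 2), eventually_gt_atTop 1]
      with n hn hn1
    refine (measureReal_le_abs_count_sub hXmeas hXindep hXlaw (hB n) n (by positivity)
      hε1).trans ?_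
    have hn0 : (0 : ℝ) < n := by positivity
    have hlogpos : 0 < Real.log n := Real.log_pos (by exact_mod_cast hn1)
    rw [le_div_iff₀ hlogpos] at hn
    have : ((n : ℝ) ^ 2)⁻¹ = Real.exp (-2 * Real.log n) := by
      rw [neg_mul, Real.exp_neg, two_mul, Real.exp_add, Real.exp_log hn0, pow_two]
    rw [this]
    refine mul_le_mul_of_nonneg_left (Real.exp_le_exp.2 ?_) zero_le_two
    have h2 : (((k : ℝ) + 1)⁻¹ ^ 2 / 4) * (8 * (k + 1) ^ 2 * Real.log n) = 2 * Real.log n := by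
      field_simp; norm_num
    have h3 := mul_le_mul_of_nonneg_left hn
      (by positivity : 0 ≤ ((k : ℝ) + 1)⁻¹ ^ 2 / 4)
    linarith
  have hpos : ∀ᶠ n : ℕ in atTop, 0 < n * μ.real (B n) := by
    filter_upwards [hlog.eventually_gt_atTop 0, eventually_gt_atTop 1] with n hn hn1
    have hlogpos : 0 < Real.log n := Real.log_pos (by exact_mod_cast hn1)
    exact (div_pos_iff_of_pos_right hlogpos).1 hn
  filter_upwards [ae_all_iff.2 hmain] with ω hω
  rw [Metric.tendsto_nhds]
  intro ε hε
  obtain ⟨k, hk⟩ := exists_nat_one_div_lt hε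
  filter_upwards [hω k, hpos] with n hn hnpos
  rw [not_le] at hn
  rw [Real.dist_eq, div_sub_one hnpos.ne', abs_div, abs_of_pos hnpos, div_lt_iff₀ hnpos]
  refine hn.trans ?_
  rw [one_div] at hk
  gcongr

end Counting

/-! ### Consequences of regular variation for the bandwidths. -/

section RegularVariation

/-- At `u = 1` the ratio tends to `1`, whereas it is `0 / 0 = 0` wherever `F` vanishes. -/
theorem RegularlyVaryingAtZero.eventually_ne_zero {F : ℝ → ℝ} {D : ℕ}
    (hF : RegularlyVaryingAtZero F D) : ∀ᶠ s in 𝓝[>] (0 : ℝ), F s ≠ 0 := by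
  have h := hF 1 one_pos
  simp only [mul_one, one_pow] at h
  filter_upwards [h.eventually_ne one_ne_zero] with s hs h0
  simp [h0] at hs

/-- A bounded function that is regularly varying at zero with index larger than `5/2` is
`O(s ^ (5/2))`. -/
theorem RegularlyVaryingAtZero.exists_sq_le {F : ℝ → ℝ} {D : ℕ}
    (hF : RegularlyVaryingAtZero F D) (hD : 2 < D) (h0 : ∀ s, 0 ≤ F s) (h1 : ∀ s, F s ≤ 1) :
    ∃ C, 0 < C ∧ ∀ᶠ s in 𝓝[>] (0 : ℝ), F s ^ 2 ≤ C * s ^ 5 := by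
  -- `1 / 32 = 4^(-5/2)`, and `4^(-D) ≤ 1 / 64` leaves room for the limit.
  have hpow : ((4 : ℝ)⁻¹) ^ D < 1 / 32 := by
    calc ((4 : ℝ)⁻¹) ^ D ≤ (4 : ℝ)⁻¹ ^ 3 := pow_le_pow_of_le_one (by norm_num) (by norm_num) hD
      _ < 1 / 32 := by norm_num
  have hev : ∀ᶠ s in 𝓝[>] (0 : ℝ), F (s * 4⁻¹) ≤ F s / 32 := by
    filter_upwards [(hF 4⁻¹ (by norm_num)).eventually_lt_const hpow, hF.eventually_ne_zero]
      with s hs hs0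
    have hpos : 0 < F s := lt_of_le_of_ne (h0 s) hs0.symm
    rw [div_lt_iff₀ hpos] at hs
    linarith
  obtain ⟨s₀, hs₀, hstep⟩ := (mem_nhdsGT_iff_exists_Ioc_subset).1 hev
  have hs₀ : 0 < s₀ := hs₀
  refine ⟨1024 / s₀ ^ 5, by positivity, ?_⟩
  -- Induction on the number of quarterings needed to reach `s` from the range `(s₀ / 4, s₀]`, where
  -- `F ≤ 1` suffices.
  have key : ∀ k : ℕ, ∀ s, 0 < s → s ≤ s₀ → s₀ < 4 ^ (k + 1) * s →
      F s ^ 2 ≤ 1024 / s₀ ^ 5 * s ^ 5 := by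
    intro k
    induction k with
    | zero =>
      intro s hs _ hs2
      rw [zero_add, pow_one] at hs2
      have h2 : F s ^ 2 ≤ 1 := pow_le_one₀ (h0 s) (h1 s)
      refine h2.trans ?_
      rw [div_mul_eq_mul_div, le_div_iff₀ (by positivity), one_mul]
      calc s₀ ^ 5 ≤ (4 * s) ^ 5 := by gcongr
        _ = 1024 * s ^ 5 := by ring
    | succ k ih =>
      intro s hs hs1 hs2
      rcases le_or_gt (4 * s) s₀ with h4 | h4
      · have h5 := ih (4 * s) (by positivity) h4 (by rw [pow_succ] at hs2; linarith)
        have h6 : F (4 * s * 4⁻¹) ≤ F (4 * s) / 32 := hstep ⟨by positivity, h4⟩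
        have h7 : 4 * s * 4⁻¹ = s := by ring
        rw [h7] at h6
        calc F s ^ 2 ≤ (F (4 * s) / 32) ^ 2 := pow_le_pow_left₀ (h0 s) h6 2
          _ = F (4 * s) ^ 2 / 1024 := by ring
          _ ≤ (1024 / s₀ ^ 5 * (4 * s) ^ 5) / 1024 := by gcongr
          _ = _ := by ring
      · have h2 : F s ^ 2 ≤ 1 := pow_le_one₀ (h0 s) (h1 s)
        refine h2.trans ?_
        rw [div_mul_eq_mul_div, le_div_iff₀ (by positivity), one_mul]
        calc s₀ ^ 5 ≤ (4 * s) ^ 5 := by gcongr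
          _ = 1024 * s ^ 5 := by ring
  filter_upwards [Ioc_mem_nhdsGT hs₀] with s hs
  obtain ⟨k, hk⟩ := pow_unbounded_of_one_lt (s₀ / s) (by norm_num : (1 : ℝ) < 4)
  refine key k s hs.1 hs.2 ?_
  rw [div_lt_iff₀ hs.1] at hk
  refine hk.trans_le ?_
  have := hs.1
  gcongr <;> simp

/-- The bandwidths cannot be too small: `1 / (n h_n²)^10` is summable. -/
theorem exists_inv_pow_bandwidth_le {F : ℝ → ℝ} {D : ℕ} (hF : RegularlyVaryingAtZero F D)
    (hD : 2 < D) (h0 : ∀ s, 0 ≤ F s) (h1 : ∀ s, F s ≤ 1) {h : ℕ → ℝ} (hpos : ∀ n, 0 < h n)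
    (hlim : Tendsto h atTop (𝓝 0))
    (hlog : Tendsto (fun n : ℕ => n * F (h n) / Real.log n) atTop atTop) :
    ∃ C, 0 < C ∧ ∀ᶠ n : ℕ in atTop, ((n * h n ^ 2) ^ 10)⁻¹ ≤ C * ((n : ℝ) ^ 2)⁻¹ := by
  obtain ⟨C, hC, hFC⟩ := hF.exists_sq_le hD h0 h1
  have hlim' : Tendsto h atTop (𝓝[>] 0) :=
    tendsto_nhdsWithin_iff.2 ⟨hlim, Eventually.of_forall hpos⟩
  refine ⟨C ^ 4, by positivity, ?_⟩
  filter_upwards [hlim'.eventually hFC, hlog.eventually_ge_atTop 1, eventually_ge_atTop 3]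
    with n hn1 hn2 hn3
  have hn0 : (0 : ℝ) < n := by positivity
  have hn3' : (3 : ℝ) ≤ n := by exact_mod_cast hn3
  have hlog1 : 1 ≤ Real.log n := by
    rw [Real.le_log_iff_exp_le hn0]
    exact (Real.exp_one_lt_d9.le.trans (by norm_num)).trans hn3'
  have hnF : 1 ≤ n * F (h n) := by
    rw [le_div_iff₀ (by linarith)] at hn2
    linarith
  have hh := hpos n
  have h2 : 1 ≤ (n : ℝ) ^ 2 * (C * h n ^ 5) := by
    calc (1 : ℝ) ≤ (n * F (h n)) ^ 2 := one_le_pow₀ hnF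
      _ = (n : ℝ) ^ 2 * F (h n) ^ 2 := by ring
      _ ≤ _ := by gcongr
  -- The exponent 10 originates here: `n² (n² h⁵)⁴ = (n h²)^10`.
  have h3 : 1 ≤ ((n : ℝ) ^ 2 * (C * h n ^ 5)) ^ 4 := one_le_pow₀ h2
  rw [← div_eq_mul_inv, inv_eq_one_div, div_le_div_iff₀ (by positivity) (by positivity)]
  calc (1 : ℝ) * n ^ 2 ≤ n ^ 2 * ((n : ℝ) ^ 2 * (C * h n ^ 5)) ^ 4 := by
        rw [one_mul]; exact le_mul_of_one_le_right (by positivity) h3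
    _ = C ^ 4 * (n * h n ^ 2) ^ 10 := by ring

end RegularVariation

/-! ### Quantitative properties of the kernel. -/

section Kernel

/-- Constants controlling a kernel. -/
theorem IsKernel.exists_constants {K : ℝ → ℝ} (hK : IsKernel K) :
    ∃ L C a b c : ℝ, 0 ≤ L ∧ 0 < C ∧ 0 < a ∧ a < b ∧ b < 1 ∧ 0 < c ∧
      (∀ v, 0 ≤ v → K v ≤ C) ∧ (∀ v, 1 < v → K v = 0) ∧
      (∀ v w, 0 ≤ v → v ≤ 1 → 0 ≤ w → w ≤ 1 → |K v - K w| ≤ L * |v - w|) ∧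
      (∀ v, a ≤ v → v ≤ b → c ≤ K v) := by
  obtain ⟨C, hC⟩ := hK.bounded
  obtain ⟨L, hL⟩ := hK.contDiff.exists_lipschitzOnWith one_ne_zero (convex_Icc 0 1) isCompact_Icc
  have hhalf : (2⁻¹ : ℝ) ∈ closure {v | 0 ≤ v ∧ K v ≠ 0} := by
    rw [hK.support]; constructor <;> norm_num
  -- The support is a closure, so `K (1/2)` may vanish; a nearby interior point does not, and
  -- continuity spreads its positivity to an interval `[a, b]`.
  obtain ⟨v₀, hv₀, hv₀pos, hKv₀⟩ := mem_closure_iff.1 hhalf (Set.Ioo 0 1) isOpen_Ioo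
    ⟨by norm_num, by norm_num⟩
  have hKpos : 0 < K v₀ := lt_of_le_of_ne (hK.nonneg v₀ hv₀pos) hKv₀.symm
  have hcont : ContinuousAt K v₀ :=
    hK.contDiff.continuousOn.continuousAt (Icc_mem_nhds hv₀.1 hv₀.2)
  have hev : ∀ᶠ v in 𝓝 v₀, K v₀ / 2 < K v ∧ v ∈ Set.Ioo (0 : ℝ) 1 :=
    (hcont.eventually_const_lt (half_lt_self hKpos)).and (Ioo_mem_nhds hv₀.1 hv₀.2)
  obtain ⟨r, hr, hball⟩ := Metric.eventually_nhds_iff.1 hev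
  have hmem : ∀ v, v₀ - r / 2 ≤ v → v ≤ v₀ + r / 2 → K v₀ / 2 < K v ∧ v ∈ Set.Ioo (0 : ℝ) 1 :=
    fun v h1 h2 => hball (by rw [Real.dist_eq, abs_lt]; constructor <;> linarith)
  refine ⟨L, max C 1, v₀ - r / 2, v₀ + r / 2, K v₀ / 2, L.2, by positivity,
    (hmem _ le_rfl (by linarith)).2.1, by linarith, (hmem _ (by linarith) le_rfl).2.2,
    by positivity, fun v hv => (hC v hv).trans (le_max_left _ _), fun v hv => ?_,
    fun v w hv0 hv1 hw0 hw1 => hL.dist_le_mul v ⟨hv0, hv1⟩ w ⟨hw0, hw1⟩,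
    fun v h1 h2 => (hmem v h1 h2).1.le⟩
  by_contra hne
  have h1 : v ∈ closure {v | 0 ≤ v ∧ K v ≠ 0} := subset_closure ⟨by linarith, hne⟩
  rw [hK.support] at h1
  exact absurd h1.2 (not_le.2 hv)

/-- `K` is unconstrained on negative arguments; on `[0, ∞)` it agrees with its continuous
restriction to `[0, 1]` extended by zero. -/
theorem IsKernel.measurable_comp {K : ℝ → ℝ} (hK : IsKernel K) {α : Type*} [MeasurableSpace α]
    {r : α → ℝ} (hr : Measurable r) (h0 : ∀ a, 0 ≤ r a) : Measurable fun a => K (r a) := by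
  obtain ⟨-, -, -, -, -, -, -, -, -, -, -, -, hK1, -, -⟩ := hK.exists_constants
  classical
  have h1 : Measurable ((Set.Icc (0 : ℝ) 1).piecewise K fun _ => 0) :=
    hK.contDiff.continuousOn.measurable_piecewise continuousOn_const measurableSet_Icc
  have h2 : (fun a => K (r a)) = ((Set.Icc (0 : ℝ) 1).piecewise K fun _ => 0) ∘ r := by
    funext a
    simp only [Function.comp_apply, Set.piecewise]
    split_ifs with h
    · rfl
    · exact hK1 _ (not_le.1 fun h' => h ⟨h0 a, h'⟩)
  rw [h2]
  exact h1.comp hr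

end Kernel

/-! ### Kernel sums compared with counts in cylinders and shells. -/

section KernelSum

set_option linter.unusedSectionVars false

variable {H : Type*} [NormedAddCommGroup H] [InnerProductSpace ℝ H]

/-- The points whose image lies in a closed ball around the image of `x`. -/
def cylinder (Pi : H →L[ℝ] H) (x : H) (t : ℝ) : Set H := {y | ‖Pi (x - y)‖ ≤ t}

/-- The points whose image lies in an annulus around the image of `x`. -/
def shell (Pi : H →L[ℝ] H) (x : H) (s t : ℝ) : Set H := cylinder Pi x t \ cylinder Pi x s

/-- Below `1 - ε` both arguments stay in `[0, 1]` and the Lipschitz bound applies; above `1 + ε`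
both terms vanish; in between, where `K` may jump at `1`, only the bound `C` is available. -/
theorem abs_kernelSum_sub_le {K : ℝ → ℝ} (hK0 : ∀ v, 0 ≤ v → 0 ≤ K v) {L C : ℝ} (hL : 0 ≤ L)
    (hC : 0 ≤ C) (hKC : ∀ v, 0 ≤ v → K v ≤ C) (hK1 : ∀ v, 1 < v → K v = 0)
    (hKL : ∀ v w, 0 ≤ v → v ≤ 1 → 0 ≤ w → w ≤ 1 → |K v - K w| ≤ L * |v - w|)
    (Pi Pi' : H →L[ℝ] H) (xs : ℕ → H) (x : H) (n : ℕ) {h ε : ℝ} (hh : 0 < h) (hε : 0 ≤ ε)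
    (hpert : ∀ i, |‖Pi' (x - xs i)‖ - ‖Pi (x - xs i)‖| ≤ ε * h) :
    |kernelSum K Pi' xs x n h - kernelSum K Pi xs x n h| ≤
      L * ε * count (cylinder Pi x (h * 1)) xs n +
        C * count (shell Pi x (h * (1 - ε)) (h * (1 + ε))) xs n := by
  unfold kernelSum count
  rw [← Finset.sum_sub_distrib, Finset.mul_sum, Finset.mul_sum, ← Finset.sum_add_distrib]
  refine (Finset.abs_sum_le_sum_abs _ _).trans (Finset.sum_le_sum fun i _ => ?_)
  set v := ‖Pi (x - xs i)‖ / h with hv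
  set w := ‖Pi' (x - xs i)‖ / h with hw
  have hv0 : 0 ≤ v := by positivity
  have hw0 : 0 ≤ w := by positivity
  have hwv : |w - v| ≤ ε := by
    rw [hw, hv, ← sub_div, abs_div, abs_of_pos hh, div_le_iff₀ hh]
    exact hpert i
  have hmem : ∀ u, xs i ∈ cylinder Pi x (h * u) ↔ v ≤ u := fun u => by
    rw [hv, div_le_iff₀ hh, mul_comm u]; rfl
  have hnn1 : 0 ≤ L * ε * (cylinder Pi x (h * 1)).indicator (fun _ => (1 : ℝ)) (xs i) :=
    mul_nonneg (by positivity) (Set.indicator_nonneg (fun _ _ => zero_le_one) _)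
  have hnn2 : 0 ≤ C * (shell Pi x (h * (1 - ε)) (h * (1 + ε))).indicator
      (fun _ => (1 : ℝ)) (xs i) :=
    mul_nonneg hC (Set.indicator_nonneg (fun _ _ => zero_le_one) _)
  have habs := abs_le.1 hwv
  rcases le_or_gt v (1 - ε) with h1 | h1
  · have hv1 : v ≤ 1 := by linarith
    rw [Set.indicator_of_mem ((hmem 1).2 hv1)] at hnn1 ⊢
    have h2 := hKL w v hw0 (by linarith) hv0 hv1
    have h3 : L * |w - v| ≤ L * ε := mul_le_mul_of_nonneg_left hwv hL
    linarith
  · rcases le_or_gt v (1 + ε) with h2 | h2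
    · have hsh : xs i ∈ shell Pi x (h * (1 - ε)) (h * (1 + ε)) :=
        ⟨(hmem _).2 h2, fun h' => absurd ((hmem _).1 h') (not_le.2 h1)⟩
      rw [Set.indicator_of_mem hsh]
      have : |K w - K v| ≤ C := by
        rw [abs_le]
        constructor <;> linarith [hKC v hv0, hKC w hw0, hK0 v hv0, hK0 w hw0]
      linarith
    · rw [hK1 v (by linarith), hK1 w (by linarith)]
      simp only [sub_zero, abs_zero]
      linarith

theorem mul_count_le_kernelSum {K : ℝ → ℝ} (hK0 : ∀ v, 0 ≤ v → 0 ≤ K v) {a b c : ℝ}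
    (hKc : ∀ v, a ≤ v → v ≤ b → c ≤ K v) (Pi : H →L[ℝ] H) (xs : ℕ → H) (x : H) (n : ℕ) {h : ℝ}
    (hh : 0 < h) :
    c * count (shell Pi x (h * a) (h * b)) xs n ≤ kernelSum K Pi xs x n h := by
  unfold kernelSum count
  rw [Finset.mul_sum]
  refine Finset.sum_le_sum fun i _ => ?_
  have hmem : ∀ u, xs i ∈ cylinder Pi x (h * u) ↔ ‖Pi (x - xs i)‖ / h ≤ u := fun u => by
    rw [div_le_iff₀ hh, mul_comm u]; rfl
  by_cases hi : xs i ∈ shell Pi x (h * a) (h * b)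
  · rw [Set.indicator_of_mem hi, mul_one]
    exact hKc _ (not_le.1 fun h' => hi.2 ((hmem a).2 h')).le ((hmem b).1 hi.1)
  · rw [Set.indicator_of_notMem hi, mul_zero]
    exact hK0 _ (by positivity)

theorem kernelSum_nonneg {K : ℝ → ℝ} (hK0 : ∀ v, 0 ≤ v → 0 ≤ K v) (Pi : H →L[ℝ] H) (xs : ℕ → H)
    (x : H) (n : ℕ) {h : ℝ} (hh : 0 < h) : 0 ≤ kernelSum K Pi xs x n h :=
  Finset.sum_nonneg fun _ _ => hK0 _ (by positivity)

theorem kernelSum_le {K : ℝ → ℝ} {C : ℝ} (hKC : ∀ v, 0 ≤ v → K v ≤ C) (Pi : H →L[ℝ] H)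
    (xs : ℕ → H) (x : H) (n : ℕ) {h : ℝ} (hh : 0 < h) : kernelSum K Pi xs x n h ≤ C * n := by
  calc kernelSum K Pi xs x n h ≤ ∑ _i ∈ Finset.range n, C :=
        Finset.sum_le_sum fun _ _ => hKC _ (by positivity)
    _ = C * n := by simp [mul_comm]

variable [MeasurableSpace H] [BorelSpace H]

theorem measurableSet_cylinder (Pi : H →L[ℝ] H) (x : H) (t : ℝ) :
    MeasurableSet (cylinder Pi x t) :=
  (isClosed_le (by fun_prop) continuous_const).measurableSet

theorem measurableSet_shell (Pi : H →L[ℝ] H) (x : H) (s t : ℝ) :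
    MeasurableSet (shell Pi x s t) :=
  (measurableSet_cylinder Pi x t).diff (measurableSet_cylinder Pi x s)

theorem measureReal_cylinder (μ : Measure H) (Pi : H →L[ℝ] H) (x : H) (t : ℝ) :
    μ.real (cylinder Pi x t) = smallBall μ Pi x t := by
  unfold smallBall cylinder
  congr 1
  ext y
  simp only [Set.mem_ofPred_eq, Metric.mem_closedBall, dist_eq_norm, map_sub]
  rw [norm_sub_rev]

variable {μ : Measure H} [IsProbabilityMeasure μ]

theorem measureReal_shell (Pi : H →L[ℝ] H) (x : H) {s t : ℝ} (hst : s ≤ t) :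
    μ.real (shell Pi x s t) = smallBall μ Pi x t - smallBall μ Pi x s := by
  have hsub : cylinder Pi x s ⊆ cylinder Pi x t := fun y hy => le_trans hy hst
  rw [shell, measureReal_sdiff hsub (measurableSet_cylinder Pi x s),
    measureReal_cylinder, measureReal_cylinder]

variable {Pi : H →L[ℝ] H} {x : H} {D : ℕ} {h : ℕ → ℝ}

theorem tendsto_measureReal_shell_div (hF : RegularlyVaryingAtZero (smallBall μ Pi x) D)
    (hpos : ∀ n, 0 < h n) (hlim : Tendsto h atTop (𝓝 0)) {s t : ℝ} (hs : 0 < s) (hst : s ≤ t) :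
    Tendsto (fun n => μ.real (shell Pi x (h n * s) (h n * t)) / smallBall μ Pi x (h n)) atTop
      (𝓝 (t ^ D - s ^ D)) := by
  have hlim' : Tendsto h atTop (𝓝[>] 0) :=
    tendsto_nhdsWithin_iff.2 ⟨hlim, Eventually.of_forall hpos⟩
  have h1 := ((hF t (hs.trans_le hst)).comp hlim').sub ((hF s hs).comp hlim')
  refine h1.congr fun n => ?_
  rw [measureReal_shell Pi x (mul_le_mul_of_nonneg_left hst (hpos n).le), sub_div]
  rfl

theorem tendsto_measureReal_cylinder_div (hF : RegularlyVaryingAtZero (smallBall μ Pi x) D)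
    (hpos : ∀ n, 0 < h n) (hlim : Tendsto h atTop (𝓝 0)) :
    Tendsto (fun n => μ.real (cylinder Pi x (h n * 1)) / smallBall μ Pi x (h n)) atTop
      (𝓝 1) := by
  have hlim' : Tendsto h atTop (𝓝[>] 0) :=
    tendsto_nhdsWithin_iff.2 ⟨hlim, Eventually.of_forall hpos⟩
  have h1 := (hF 1 one_pos).comp hlim'
  rw [one_pow] at h1
  refine h1.congr fun n => ?_
  rw [measureReal_cylinder]
  rfl

end KernelSum

/-! ### Counts and second moments normalized by the small-ball mass. -/

section CountRatio

variable {E Ω : Type*} [MeasurableSpace Ω] {P : Measure Ω} [IsProbabilityMeasure P]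
  [MeasurableSpace E] {μ : Measure E} {X : ℕ → Ω → E}

theorem ae_tendsto_count_div_of_tendsto (hXmeas : ∀ i, Measurable (X i))
    (hXindep : iIndepFun X P) (hXlaw : ∀ i, P.map (X i) = μ) {B : ℕ → Set E}
    (hB : ∀ n, MeasurableSet (B n)) {F : ℕ → ℝ} {κ : ℝ} (hκ : 0 < κ)
    (hlim : Tendsto (fun n => μ.real (B n) / F n) atTop (𝓝 κ))
    (hlog : Tendsto (fun n : ℕ => n * F n / Real.log n) atTop atTop) :
    ∀ᵐ ω ∂P, Tendsto (fun n => count (B n) (fun i => X i ω) n / (n * F n)) atTop (𝓝 κ) := by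
  have hF : ∀ᶠ n in atTop, F n ≠ 0 := by
    filter_upwards [hlog.eventually_gt_atTop 0] with n hn h0
    simp [h0] at hn
  have hlogB : Tendsto (fun n : ℕ => n * μ.real (B n) / Real.log n) atTop atTop := by
    refine (hlim.pos_mul_atTop hκ hlog).congr' ?_
    filter_upwards [hF] with n hn
    field_simp
  filter_upwards [ae_tendsto_count_div hXmeas hXindep hXlaw hB hlogB] with ω hω
  have h1 := hω.mul hlim
  rw [one_mul] at h1
  refine h1.congr' ?_
  filter_upwards [hF, hlim.eventually_ne hκ.ne', eventually_ne_atTop 0] with n hn hn2 hn3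
  have hμ : μ.real (B n) ≠ 0 := fun h0 => hn2 (by simp [h0])
  have : (n : ℝ) ≠ 0 := by exact_mod_cast hn3
  field_simp

theorem tendsto_mul_atTop_of_div_log {F : ℕ → ℝ}
    (hlog : Tendsto (fun n : ℕ => n * F n / Real.log n) atTop atTop) :
    Tendsto (fun n : ℕ => n * F n) atTop atTop := by
  have h1 : Tendsto (fun n : ℕ => Real.log n) atTop atTop :=
    Real.tendsto_log_atTop.comp tendsto_natCast_atTop_atTop
  refine (hlog.atTop_mul_atTop₀ h1).congr' ?_
  filter_upwards [eventually_gt_atTop 1] with n hn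
  have : Real.log n ≠ 0 := (Real.log_pos (by exact_mod_cast hn)).ne'
  field_simp

/-- The linear term is negligible because `n F n → ∞`, leaving the square of the mass ratio. -/
theorem tendsto_second_moment_bound_div {p F : ℕ → ℝ} {κ : ℝ}
    (hlim : Tendsto (fun n => p n / F n) atTop (𝓝 κ))
    (hlog : Tendsto (fun n : ℕ => n * F n / Real.log n) atTop atTop) :
    Tendsto (fun n : ℕ => (n * p n + (n * p n) ^ 2) / (n * F n) ^ 2) atTop (𝓝 (κ ^ 2)) := by
  have hf := tendsto_mul_atTop_of_div_log hlog
  have h1 := (hlim.mul (tendsto_inv_atTop_zero.comp hf)).add (hlim.pow 2)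
  rw [mul_zero, zero_add] at h1
  refine h1.congr' ?_
  filter_upwards [hf.eventually_gt_atTop 0, eventually_ne_atTop 0] with n hn hn0
  have hn0' : (n : ℝ) ≠ 0 := by exact_mod_cast hn0
  have hF0 : F n ≠ 0 := fun h0 => by simp [h0] at hn
  simp only [Function.comp_apply]
  field_simp

end CountRatio

/-! ### Asymptotic equivalence under a negligible perturbation. -/

section Comparison

set_option linter.unusedSectionVars false

variable {H : Type*} [NormedAddCommGroup H] [InnerProductSpace ℝ H]
  [TopologicalSpace.SeparableSpace H] [MeasurableSpace H] [BorelSpace H]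
  {Ω : Type*} [MeasurableSpace Ω] {P : Measure Ω} [IsProbabilityMeasure P]
  {μ : Measure H} [IsProbabilityMeasure μ] {X : ℕ → Ω → H}
  {Pi : H →L[ℝ] H} {Pihat : ℕ → Ω → H →L[ℝ] H} {x : H} {D : ℕ} {h : ℕ → ℝ} {K : ℝ → ℝ}

/-- The projectors `Pihat n` and `Pi` agree on the sample up to `ε * h n`, outside of an event
whose probability is `O(1 / n²)`, for every `ε`. -/
def IsNegligiblePerturbation (P : Measure Ω) (X : ℕ → Ω → H) (Pi : H →L[ℝ] H)
    (Pihat : ℕ → Ω → H →L[ℝ] H) (x : H) (h : ℕ → ℝ) : Prop :=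
  ∀ ε : ℝ, 0 < ε → ∃ (bad : ℕ → Set Ω) (C : ℝ), 0 ≤ C ∧ (∀ n, MeasurableSet (bad n)) ∧
    (∀ᶠ n : ℕ in atTop, P.real (bad n) ≤ C * ((n : ℝ) ^ 2)⁻¹) ∧
    ∀ᶠ n in atTop, ∀ᵐ ω ∂P, ω ∉ bad n →
      ∀ i, |‖Pihat n ω (x - X i ω)‖ - ‖Pi (x - X i ω)‖| ≤ ε * h n

theorem IsNegligiblePerturbation.ae_eventually
    (hpert : IsNegligiblePerturbation P X Pi Pihat x h) {ε : ℝ} (hε : 0 < ε) :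
    ∀ᵐ ω ∂P, ∀ᶠ n in atTop,
      ∀ i, |‖Pihat n ω (x - X i ω)‖ - ‖Pi (x - X i ω)‖| ≤ ε * h n := by
  obtain ⟨bad, C, -, -, hprob, hgood⟩ := hpert ε hε
  obtain ⟨N, hN⟩ := eventually_atTop.1 hgood
  have h1 : ∀ᵐ ω ∂P, ∀ n, N ≤ n → ω ∉ bad n →
      ∀ i, |‖Pihat n ω (x - X i ω)‖ - ‖Pi (x - X i ω)‖| ≤ ε * h n := by
    rw [ae_all_iff]
    intro n
    by_cases hn : N ≤ n
    · filter_upwards [hN n hn] with ω hω _ using hω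
    · exact Eventually.of_forall fun ω hn' => absurd hn' hn
  filter_upwards [h1, ae_eventually_notMem_of_le_inv_sq hprob] with ω hω1 hω2
  filter_upwards [hω2, eventually_ge_atTop N] with n hn1 hn2
  exact hω1 n hn2 hn1

/-- These tolerances are countable, so one null set serves them all, and lie below `1`, so the inner
shell radius stays positive as regular variation requires. -/
theorem tendsto_inv_add_two : Tendsto (fun k : ℕ => ((k : ℝ) + 2)⁻¹) atTop (𝓝 0) :=
  tendsto_inv_atTop_zero.comp (tendsto_atTop_add_const_right _ _ tendsto_natCast_atTop_atTop)

/-- The limiting relative mass of a thin shell. -/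
theorem tendsto_shell_mass (D : ℕ) :
    Tendsto (fun k : ℕ => (1 + ((k : ℝ) + 2)⁻¹) ^ D - (1 - ((k : ℝ) + 2)⁻¹) ^ D) atTop (𝓝 0) := by
  have h2 := ((tendsto_inv_add_two.const_add 1).pow D).sub ((tendsto_inv_add_two.const_sub 1).pow D)
  simpa using h2

theorem inv_add_two_pos (k : ℕ) : 0 < ((k : ℝ) + 2)⁻¹ := by positivity

theorem inv_add_two_lt_one (k : ℕ) : ((k : ℝ) + 2)⁻¹ < 1 :=
  inv_lt_one_of_one_lt₀ (by linarith [Nat.cast_nonneg (α := ℝ) k])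

theorem shell_mass_pos (hD : 0 < D) (k : ℕ) :
    0 < (1 + ((k : ℝ) + 2)⁻¹) ^ D - (1 - ((k : ℝ) + 2)⁻¹) ^ D := by
  have h1 := inv_add_two_pos k
  have h2 := inv_add_two_lt_one k
  exact sub_pos.2 (pow_lt_pow_left₀ (by linarith) (by linarith) hD.ne')

theorem kernelSum_isEquivalent_ae (hXmeas : ∀ i, Measurable (X i)) (hXindep : iIndepFun X P)
    (hXlaw : ∀ i, P.map (X i) = μ) (hK : IsKernel K) (hD : 0 < D)
    (hF : RegularlyVaryingAtZero (smallBall μ Pi x) D) (hpos : ∀ n, 0 < h n)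
    (hlim : Tendsto h atTop (𝓝 0))
    (hlog : Tendsto (fun n : ℕ => n * smallBall μ Pi x (h n) / Real.log n) atTop atTop)
    (hpert : IsNegligiblePerturbation P X Pi Pihat x h) :
    ∀ᵐ ω ∂P, (fun n => kernelSum K (Pihat n ω) (fun i => X i ω) x n (h n)) ~[atTop]
      (fun n => kernelSum K Pi (fun i => X i ω) x n (h n)) := by
  obtain ⟨L, C, a, b, c, hL, hC, ha, hab, hb, hc, hKC, hK1, hKL, hKc⟩ := hK.exists_constants
  have hκ₀ : 0 < b ^ D - a ^ D := sub_pos.2 (pow_lt_pow_left₀ hab ha.le hD.ne')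
  have hball := ae_tendsto_count_div_of_tendsto hXmeas hXindep hXlaw
    (fun n => measurableSet_cylinder Pi x (h n * 1)) one_pos
    (tendsto_measureReal_cylinder_div hF hpos hlim) hlog
  have hinner := ae_tendsto_count_div_of_tendsto hXmeas hXindep hXlaw
    (fun n => measurableSet_shell Pi x (h n * a) (h n * b)) hκ₀
    (tendsto_measureReal_shell_div hF hpos hlim ha hab.le) hlog
  have hshell := ae_all_iff.2 fun k : ℕ => ae_tendsto_count_div_of_tendsto hXmeas hXindep hXlaw
    (fun n => measurableSet_shell Pi x (h n * (1 - ((k : ℝ) + 2)⁻¹))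
      (h n * (1 + ((k : ℝ) + 2)⁻¹))) (shell_mass_pos hD k)
    (tendsto_measureReal_shell_div hF hpos hlim (sub_pos.2 (inv_add_two_lt_one k))
      (by linarith [inv_add_two_pos k])) hlog
  have hgood := ae_all_iff.2 fun k : ℕ => hpert.ae_eventually (inv_add_two_pos k)
  have hf := tendsto_mul_atTop_of_div_log hlog
  filter_upwards [hball, hinner, hshell, hgood] with ω h1 h2 h3 h4
  refine isLittleO_iff.2 fun {η} hη => ?_
  have hsmall : Tendsto (fun k : ℕ => L * ((k : ℝ) + 2)⁻¹ * 1 +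
      C * ((1 + ((k : ℝ) + 2)⁻¹) ^ D - (1 - ((k : ℝ) + 2)⁻¹) ^ D)) atTop (𝓝 0) := by
    simpa using ((tendsto_inv_add_two.const_mul L).mul_const 1).add
      ((tendsto_shell_mass D).const_mul C)
  -- The tolerance is fixed from `η` before `n → ∞`: the limiting error must lie below `η` times the
  -- limiting lower bound for the original sum.
  obtain ⟨k, hk⟩ := (hsmall.eventually_lt_const
    (show 0 < η * (c * (b ^ D - a ^ D)) by positivity)).exists
  have hup := (h1.const_mul (L * ((k : ℝ) + 2)⁻¹)).add ((h3 k).const_mul C)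
  have hlow := (h2.const_mul c).const_mul η
  filter_upwards [hup.eventually_lt hlow hk, h4 k, hf.eventually_gt_atTop 0] with n hn hn4 hn0
  have hle := abs_kernelSum_sub_le hK.nonneg hL hC.le hKC hK1 hKL Pi (Pihat n ω)
    (fun i => X i ω) x n (hpos n) (inv_add_two_pos k).le hn4
  have hge := mul_count_le_kernelSum hK.nonneg hKc Pi (fun i => X i ω) x n (hpos n)
  rw [_root_.Pi.sub_apply, Real.norm_eq_abs, Real.norm_of_nonneg (kernelSum_nonneg hK.nonneg _ _ _ _ (hpos n))]
  refine hle.trans (le_trans ?_ (mul_le_mul_of_nonneg_left hge hη.le))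
  simp only [← mul_div_assoc] at hn
  rw [← add_div, div_lt_div_iff_of_pos_right hn0] at hn
  exact hn.le

/-- The projector is evaluated at a random point, so joint measurability is needed; it follows from
continuity in the vector and measurability in `ω` (Carathéodory). -/
theorem measurable_kernelSum (hXmeas : ∀ i, Measurable (X i)) (hK : IsKernel K) (n : ℕ)
    {Q : Ω → H →L[ℝ] H} (hQ : ∀ v, Measurable fun ω => Q ω v) {r : ℝ} (hr : 0 < r) :
    Measurable fun ω => kernelSum K (Q ω) (fun i => X i ω) x n r := by
  have : SecondCountableTopology H := UniformSpace.secondCountable_of_separable H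
  have h1 : Measurable (Function.uncurry fun (v : H) (ω : Ω) => Q ω v) :=
    measurable_uncurry_of_continuous_of_measurable (fun ω => (Q ω).continuous) hQ
  refine Finset.measurable_fun_sum _ fun i _ => hK.measurable_comp ?_ fun ω => by positivity
  have h2 : Measurable fun ω => Q ω (x - X i ω) :=
    h1.comp ((measurable_const.sub (hXmeas i)).prodMk measurable_id)
  exact h2.norm.div_const r

theorem integrable_kernelSum_pow (hXmeas : ∀ i, Measurable (X i)) (hK : IsKernel K) (n : ℕ)
    {Q : Ω → H →L[ℝ] H} (hQ : ∀ v, Measurable fun ω => Q ω v) {r : ℝ} (hr : 0 < r) (m : ℕ) :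
    Integrable (fun ω => kernelSum K (Q ω) (fun i => X i ω) x n r ^ m) P := by
  obtain ⟨C, hC⟩ := hK.bounded
  refine Integrable.of_bound ((measurable_kernelSum hXmeas hK n hQ hr).pow_const
    m).aestronglyMeasurable ((C * n) ^ m) (Eventually.of_forall fun ω => ?_)
  rw [norm_pow, Real.norm_of_nonneg (kernelSum_nonneg hK.nonneg _ _ _ _ hr)]
  exact pow_le_pow_left₀ (kernelSum_nonneg hK.nonneg _ _ _ _ hr) (kernelSum_le hC _ _ _ _ hr) _

/-- Jensen's inequality, applied to the lower bound for the mean coming from the interval where `K ≥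
c`. -/
theorem sq_mul_count_le_integral_kernelSum_sq (hXmeas : ∀ i, Measurable (X i))
    (hXlaw : ∀ i, P.map (X i) = μ) (hK : IsKernel K) {a b c : ℝ} (hc : 0 ≤ c)
    (hKc : ∀ v, a ≤ v → v ≤ b → c ≤ K v) (n : ℕ) {r : ℝ} (hr : 0 < r) :
    (c * (n * μ.real (shell Pi x (r * a) (r * b)))) ^ 2 ≤
      ∫ ω, kernelSum K Pi (fun i => X i ω) x n r ^ 2 ∂P := by
  have hm := measurable_kernelSum (x := x) hXmeas hK n (Q := fun _ => Pi)
    (fun v => measurable_const) hr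
  have hi1 := integrable_kernelSum_pow (P := P) (x := x) hXmeas hK n (Q := fun _ => Pi)
    (fun v => measurable_const) hr 1
  have hi2 := integrable_kernelSum_pow (P := P) (x := x) hXmeas hK n (Q := fun _ => Pi)
    (fun v => measurable_const) hr 2
  simp only [pow_one] at hi1
  have hB := measurableSet_shell Pi x (r * a) (r * b)
  have h1 : c * (n * μ.real (shell Pi x (r * a) (r * b))) ≤
      ∫ ω, kernelSum K Pi (fun i => X i ω) x n r ∂P := by
    rw [← integral_count hXmeas hXlaw hB, ← integral_const_mul]
    refine integral_mono (Integrable.const_mul ?_ _) hi1 fun ω =>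
      mul_count_le_kernelSum hK.nonneg hKc Pi _ x n hr
    simpa only [pow_one] using integrable_count_pow (P := P) hXmeas hB n 1
  have h2 : (∫ ω, kernelSum K Pi (fun i => X i ω) x n r ∂P) ^ 2 ≤
      ∫ ω, kernelSum K Pi (fun i => X i ω) x n r ^ 2 ∂P := by
    have hmem : MemLp (fun ω => kernelSum K Pi (fun i => X i ω) x n r) 2 P :=
      (memLp_two_iff_integrable_sq hm.aestronglyMeasurable).2 hi2
    have := variance_nonneg (fun ω => kernelSum K Pi (fun i => X i ω) x n r) P
    rw [variance_eq_sub hmem] at this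
    simp only [_root_.Pi.pow_apply] at this
    linarith
  exact (pow_le_pow_left₀ (by positivity) h1 2).trans h2

/-- Second moment of the error of the kernel sum for a perturbed projector. -/
theorem abs_integral_kernelSum_sq_sub_le (hXmeas : ∀ i, Measurable (X i))
    (hXindep : iIndepFun X P) (hXlaw : ∀ i, P.map (X i) = μ) (hK : IsKernel K)
    {L C : ℝ} (hL : 0 ≤ L) (hC : 0 ≤ C) (hKC : ∀ v, 0 ≤ v → K v ≤ C) (hK1 : ∀ v, 1 < v → K v = 0)
    (hKL : ∀ v w, 0 ≤ v → v ≤ 1 → 0 ≤ w → w ≤ 1 → |K v - K w| ≤ L * |v - w|)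
    (n : ℕ) {Q : Ω → H →L[ℝ] H} (hQ : ∀ v, Measurable fun ω => Q ω v) {r ε η : ℝ} (hr : 0 < r)
    (hε : 0 ≤ ε) (hη : 0 < η) {bad : Set Ω} (hbad : MeasurableSet bad)
    (hpert : ∀ᵐ ω ∂P, ω ∉ bad → ∀ i, |‖Q ω (x - X i ω)‖ - ‖Pi (x - X i ω)‖| ≤ ε * r) :
    |∫ ω, kernelSum K (Q ω) (fun i => X i ω) x n r ^ 2 ∂P -
        ∫ ω, kernelSum K Pi (fun i => X i ω) x n r ^ 2 ∂P| ≤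
      η / 2 * ∫ ω, kernelSum K Pi (fun i => X i ω) x n r ^ 2 ∂P + (1 + 2 / η) *
        (2 * (L * ε) ^ 2 * (n * μ.real (cylinder Pi x (r * 1)) +
          (n * μ.real (cylinder Pi x (r * 1))) ^ 2) +
        2 * C ^ 2 * (n * μ.real (shell Pi x (r * (1 - ε)) (r * (1 + ε))) +
          (n * μ.real (shell Pi x (r * (1 - ε)) (r * (1 + ε)))) ^ 2) +
        (C * n) ^ 2 * P.real bad) := by
  set B := cylinder Pi x (r * 1)
  set A := shell Pi x (r * (1 - ε)) (r * (1 + ε))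
  have hBm : MeasurableSet B := measurableSet_cylinder _ _ _
  have hAm : MeasurableSet A := measurableSet_shell _ _ _ _
  set S := fun ω => kernelSum K Pi (fun i => X i ω) x n r with hS
  set T := fun ω => kernelSum K (Q ω) (fun i => X i ω) x n r with hT
  have hSi : Integrable (fun ω => S ω ^ 2) P := integrable_kernelSum_pow (P := P) (x := x) hXmeas
    hK n (Q := fun _ => Pi) (fun v => measurable_const) hr 2
  have hTi : Integrable (fun ω => T ω ^ 2) P := integrable_kernelSum_pow hXmeas hK n hQ hr 2
  have hBi := integrable_count_pow (P := P) hXmeas hBm n 2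
  have hAi := integrable_count_pow (P := P) hXmeas hAm n 2
  have hbadi : Integrable (bad.indicator fun _ => (1 : ℝ)) P :=
    (integrable_const 1).indicator hbad
  set U := fun ω => 2 * (L * ε) ^ 2 * count B (fun i => X i ω) n ^ 2 +
    2 * C ^ 2 * count A (fun i => X i ω) n ^ 2 +
      (C * n) ^ 2 * bad.indicator (fun _ => (1 : ℝ)) ω with hU
  have hUi : Integrable U P :=
    ((hBi.const_mul _).add (hAi.const_mul _)).add (hbadi.const_mul _)
  have hdiff : ∀ᵐ ω ∂P, (T ω - S ω) ^ 2 ≤ U ω := by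
    filter_upwards [hpert] with ω hω
    by_cases hb : ω ∈ bad
    · have h1 : |T ω - S ω| ≤ C * n := by
        have hT0 : 0 ≤ T ω := kernelSum_nonneg hK.nonneg _ _ _ _ hr
        have hT1 : T ω ≤ C * n := kernelSum_le hKC _ _ _ _ hr
        have hS0 : 0 ≤ S ω := kernelSum_nonneg hK.nonneg _ _ _ _ hr
        have hS1 : S ω ≤ C * n := kernelSum_le hKC _ _ _ _ hr
        rw [abs_le]; constructor <;> linarith
      have h2 : (T ω - S ω) ^ 2 ≤ (C * n) ^ 2 := by
        rw [← sq_abs]; gcongr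
      have h3 : 0 ≤ 2 * (L * ε) ^ 2 * count B (fun i => X i ω) n ^ 2 +
        2 * C ^ 2 * count A (fun i => X i ω) n ^ 2 := by positivity
      simp only [hU, Set.indicator_of_mem hb, mul_one]
      linarith
    · have h1 := abs_kernelSum_sub_le hK.nonneg hL hC hKC hK1 hKL Pi (Q ω)
        (fun i => X i ω) x n hr hε (hω hb)
      have h2 : (T ω - S ω) ^ 2 ≤ (L * ε * count B (fun i => X i ω) n +
          C * count A (fun i => X i ω) n) ^ 2 := by
        rw [← sq_abs]; exact pow_le_pow_left₀ (abs_nonneg _) h1 2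
      simp only [hU, Set.indicator_of_notMem hb, mul_zero, add_zero]
      nlinarith [sq_nonneg (L * ε * count B (fun i => X i ω) n -
          C * count A (fun i => X i ω) n)]
  have hpoint : ∀ᵐ ω ∂P, |T ω ^ 2 - S ω ^ 2| ≤ η / 2 * S ω ^ 2 + (1 + 2 / η) * U ω := by
    filter_upwards [hdiff] with ω hω
    -- Young's inequality for the cross term `2 S (T - S)`, obtained from the two squares below.
    have h1 : |T ω ^ 2 - S ω ^ 2| ≤ η / 2 * S ω ^ 2 + (1 + 2 / η) * (T ω - S ω) ^ 2 := by
      have e : T ω ^ 2 - S ω ^ 2 = (T ω - S ω) ^ 2 + 2 * (S ω * (T ω - S ω)) := by ring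
      have h2 : 0 ≤ (η * S ω - 2 * (T ω - S ω)) ^ 2 / (2 * η) := by positivity
      have h3 : 0 ≤ (η * S ω + 2 * (T ω - S ω)) ^ 2 / (2 * η) := by positivity
      have e2 : (η * S ω - 2 * (T ω - S ω)) ^ 2 / (2 * η) =
          η / 2 * S ω ^ 2 - 2 * (S ω * (T ω - S ω)) + 2 / η * (T ω - S ω) ^ 2 := by
        field_simp; ring
      have e3 : (η * S ω + 2 * (T ω - S ω)) ^ 2 / (2 * η) =
          η / 2 * S ω ^ 2 + 2 * (S ω * (T ω - S ω)) + 2 / η * (T ω - S ω) ^ 2 := by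
        field_simp; ring
      rw [e2] at h2
      rw [e3] at h3
      rw [e, abs_le]
      constructor <;> nlinarith [sq_nonneg (T ω - S ω)]
    refine h1.trans ?_
    gcongr
  have hUint : ∫ ω, U ω ∂P ≤ 2 * (L * ε) ^ 2 * (n * μ.real B + (n * μ.real B) ^ 2) +
      2 * C ^ 2 * (n * μ.real A + (n * μ.real A) ^ 2) + (C * n) ^ 2 * P.real bad := by
    have hBAi : Integrable (fun ω => 2 * (L * ε) ^ 2 * count B (fun i => X i ω) n ^ 2 +
        2 * C ^ 2 * count A (fun i => X i ω) n ^ 2) P := (hBi.const_mul _).add (hAi.const_mul _)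
    simp only [hU]
    rw [integral_add hBAi (hbadi.const_mul _),
      integral_add (hBi.const_mul _) (hAi.const_mul _), integral_const_mul, integral_const_mul,
      integral_const_mul]
    have h1 : ∫ ω, bad.indicator (fun _ => (1 : ℝ)) ω ∂P = P.real bad := integral_indicator_one hbad
    rw [h1]
    gcongr
    · exact integral_count_sq_le hXmeas hXindep hXlaw hBm n
    · exact integral_count_sq_le hXmeas hXindep hXlaw hAm n
  calc |∫ ω, T ω ^ 2 ∂P - ∫ ω, S ω ^ 2 ∂P| = |∫ ω, (T ω ^ 2 - S ω ^ 2) ∂P| := by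
        rw [integral_sub hTi hSi]
    _ ≤ ∫ ω, |T ω ^ 2 - S ω ^ 2| ∂P := abs_integral_le_integral_abs
    _ ≤ ∫ ω, (η / 2 * S ω ^ 2 + (1 + 2 / η) * U ω) ∂P :=
        integral_mono_ae (hTi.sub hSi).abs ((hSi.const_mul _).add (hUi.const_mul _)) hpoint
    _ = η / 2 * ∫ ω, S ω ^ 2 ∂P + (1 + 2 / η) * ∫ ω, U ω ∂P := by
        rw [integral_add (hSi.const_mul _) (hUi.const_mul _), integral_const_mul,
          integral_const_mul]
    _ ≤ _ := by gcongr

theorem integral_kernelSum_sq_isEquivalent (hXmeas : ∀ i, Measurable (X i))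
    (hXindep : iIndepFun X P)
    (hXlaw : ∀ i, P.map (X i) = μ) (hK : IsKernel K) (hD : 0 < D)
    (hF : RegularlyVaryingAtZero (smallBall μ Pi x) D) (hpos : ∀ n, 0 < h n)
    (hlim : Tendsto h atTop (𝓝 0))
    (hlog : Tendsto (fun n : ℕ => n * smallBall μ Pi x (h n) / Real.log n) atTop atTop)
    (hPihat : ∀ n v, Measurable fun ω => Pihat n ω v)
    (hpert : IsNegligiblePerturbation P X Pi Pihat x h) :
    (fun n => ∫ ω, kernelSum K (Pihat n ω) (fun i => X i ω) x n (h n) ^ 2 ∂P) ~[atTop]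
      (fun n => ∫ ω, kernelSum K Pi (fun i => X i ω) x n (h n) ^ 2 ∂P) := by
  obtain ⟨L, C, a, b, c, hL, hC, ha, hab, hb, hc, hKC, hK1, hKL, hKc⟩ := hK.exists_constants
  have hκ₀ : 0 < b ^ D - a ^ D := sub_pos.2 (pow_lt_pow_left₀ hab ha.le hD.ne')
  have hf := tendsto_mul_atTop_of_div_log hlog
  refine isLittleO_iff.2 fun {η} hη => ?_
  have hsmall : Tendsto (fun k : ℕ => (1 + 2 / η) * (2 * (L * ((k : ℝ) + 2)⁻¹) ^ 2 * 1 ^ 2 +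
      2 * C ^ 2 * ((1 + ((k : ℝ) + 2)⁻¹) ^ D - (1 - ((k : ℝ) + 2)⁻¹) ^ D) ^ 2 + 0)) atTop
        (𝓝 0) := by
    have := (((((tendsto_inv_add_two.const_mul L).pow 2).const_mul 2).mul_const (1 ^ 2)).add
      (((tendsto_shell_mass D).pow 2).const_mul (2 * C ^ 2))).add_const 0 |>.const_mul (1 + 2 / η)
    simpa using this
  obtain ⟨k, hk⟩ := (hsmall.eventually_lt_const
    (show 0 < η / 2 * (c * (b ^ D - a ^ D)) ^ 2 by positivity)).exists
  obtain ⟨bad, C₁, hC₁, hbadm, hbadP, hgood⟩ := hpert _ (inv_add_two_pos k)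
  have hBlim := tendsto_second_moment_bound_div
    (tendsto_measureReal_cylinder_div hF hpos hlim) hlog
  have hAlim := tendsto_second_moment_bound_div
    (tendsto_measureReal_shell_div hF hpos hlim (sub_pos.2 (inv_add_two_lt_one k))
      (by linarith [inv_add_two_pos k] : 1 - ((k : ℝ) + 2)⁻¹ ≤ 1 + ((k : ℝ) + 2)⁻¹)) hlog
  have hErr : Tendsto (fun n : ℕ => C ^ 2 * C₁ / (n * smallBall μ Pi x (h n)) ^ 2) atTop
      (𝓝 0) := by
    have h1 : Tendsto (fun n : ℕ => (n * smallBall μ Pi x (h n)) ^ 2) atTop atTop :=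
      (tendsto_pow_atTop two_ne_zero).comp hf
    exact h1.const_div_atTop _
  have hup := (((hBlim.const_mul (2 * (L * ((k : ℝ) + 2)⁻¹) ^ 2)).add
    (hAlim.const_mul (2 * C ^ 2))).add hErr).const_mul (1 + 2 / η)
  have hlow := (((tendsto_measureReal_shell_div hF hpos hlim ha hab.le).const_mul c).pow
    2).const_mul (η / 2)
  filter_upwards [hup.eventually_lt hlow hk, hf.eventually_gt_atTop 0, hbadP, hgood,
    eventually_ne_atTop 0] with n hn hn0 hnbad hngood hnne
  have hle := abs_integral_kernelSum_sq_sub_le hXmeas hXindep hXlaw hK hL hC.le hKC hK1 hKL n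
    (hPihat n) (hpos n) (inv_add_two_pos k).le hη (hbadm n) hngood
  have hge := sq_mul_count_le_integral_kernelSum_sq (Pi := Pi) (x := x) hXmeas hXlaw hK hc.le hKc
    n (hpos n)
  have hn' : (0 : ℝ) < n := by positivity
  -- The decay `n^(-2)` exactly offsets the trivial bound `(C n)²` on the bad event.
  have hbadn : (C * n) ^ 2 * P.real (bad n) ≤ C ^ 2 * C₁ := by
    calc (C * n) ^ 2 * P.real (bad n) ≤ (C * n) ^ 2 * (C₁ * ((n : ℝ) ^ 2)⁻¹) := by gcongr
      _ = C ^ 2 * C₁ := by field_simp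
  have hlow_eq : ∀ z, η / 2 * (c * (z / smallBall μ Pi x (h n))) ^ 2 =
      (η / 2 * (c * (n * z)) ^ 2) / (n * smallBall μ Pi x (h n)) ^ 2 := fun z => by
    have hF0 : smallBall μ Pi x (h n) ≠ 0 := fun h0 => by simp [h0] at hn0
    field_simp
  rw [hlow_eq] at hn
  simp only [← mul_div_assoc] at hn
  rw [← add_div, ← add_div, ← mul_div_assoc,
    div_lt_div_iff_of_pos_right (by positivity)] at hn
  rw [_root_.Pi.sub_apply, Real.norm_eq_abs,
    Real.norm_of_nonneg (integral_nonneg fun ω => sq_nonneg _)]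
  refine hle.trans ?_
  have h1 := mul_le_mul_of_nonneg_left hge (by positivity : 0 ≤ η / 2)
  have h2 := mul_le_mul_of_nonneg_left hbadn (by positivity : 0 ≤ 1 + 2 / η)
  linarith

end Comparison

/-! ### The empirical projector as a negligible perturbation. -/

section Main

variable {H : Type*} [NormedAddCommGroup H] [InnerProductSpace ℝ H] [CompleteSpace H]
  [TopologicalSpace.SeparableSpace H] [MeasurableSpace H] [BorelSpace H]
  {Ω : Type*} [MeasurableSpace Ω] {P : Measure Ω} [IsProbabilityMeasure P]
  {μ : Measure H} [IsProbabilityMeasure μ] {X : ℕ → Ω → H} {D : ℕ}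

/-- The empirical projector is a negligible perturbation of the projector at bandwidths that are not
too small. -/
theorem isNegligiblePerturbation_proj {R : ℝ} (hR : ∀ᵐ y ∂μ, ‖y‖ ≤ R)
    (hXmeas : ∀ i, Measurable (X i)) (hXindep : iIndepFun X P) (hXlaw : ∀ i, P.map (X i) = μ)
    (hD : 0 < D) {e : Fin D → H} {lam : Fin D → ℝ}
    (he : IsLeadingEigensystem (covOp μ) e lam) (hsep : IsSeparated (covOp μ) e lam)
    {ehat : ℕ → Ω → Fin D → H} {lamhat : ℕ → Ω → Fin D → ℝ}
    (hehat : ∀ n ω, IsLeadingEigensystem (empCovOp (fun i => X i ω) n) (ehat n ω) (lamhat n ω))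
    (x : H) {h : ℕ → ℝ} (hpos : ∀ n, 0 < h n) (hlim : Tendsto h atTop (𝓝 0)) {C : ℝ} (hC : 0 ≤ C)
    (hrate : ∀ᶠ n : ℕ in atTop, ((n * h n ^ 2) ^ 10)⁻¹ ≤ C * ((n : ℝ) ^ 2)⁻¹) :
    IsNegligiblePerturbation P X (proj e) (fun n ω => proj (ehat n ω)) x h := by
  intro ε hε
  rw [← coe_covCLM hR] at he hsep
  obtain ⟨g, t, hg, ht, hgap⟩ := hsep.exists_rayleigh_gap (isCompactOperator_covCLM hR)
    (covCLM_symm hR) (covCLM_nonneg hR) he hD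
  -- Order `9 + 1 = 10` matches the power of `n h_n²` in the rate hypothesis.
  obtain ⟨dev, hdevm, -, hdev, C₀, hC₀, hprob⟩ :=
    exists_covariance_deviation hR hXmeas hXindep hXlaw 9
  set M := Real.sqrt D * (2 / g) * (‖x‖ + |R|) with hM
  have hM0 : 0 ≤ M := by positivity
  set η := ε / (M + 1) with hη
  have hη0 : 0 < η := by positivity
  have hηM : η * M ≤ ε := by
    rw [hη, div_mul_eq_mul_div, div_le_iff₀ (by positivity)]
    nlinarith
  refine ⟨fun n => {ω | η * h n ≤ dev n ω}, C₀ * (η ^ 20)⁻¹ * C, by positivity,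
    fun n => measurableSet_le measurable_const (hdevm n), ?_, ?_⟩
  · filter_upwards [hrate, eventually_ne_atTop 0] with n hn hn0
    have hh := hpos n
    calc P.real {ω | η * h n ≤ dev n ω} ≤ C₀ / (n * (η * h n) ^ 2) ^ (9 + 1) :=
          hprob n _ hn0 (by positivity)
      _ = C₀ * (η ^ 20)⁻¹ * ((n * h n ^ 2) ^ 10)⁻¹ := by
          have : (n : ℝ) ≠ 0 := by exact_mod_cast hn0
          field_simp
          ring
      _ ≤ C₀ * (η ^ 20)⁻¹ * (C * ((n : ℝ) ^ 2)⁻¹) := by gcongr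
      _ = _ := by ring
  -- Davis–Kahan applies only when the perturbation is at most half the gap.
  · have hsmall : ∀ᶠ n in atTop, η * h n < g / 2 := by
      have := hlim.const_mul η
      rw [mul_zero] at this
      exact this.eventually_lt_const (by positivity)
    have hXR : ∀ᵐ ω ∂P, ∀ i, ‖X i ω‖ ≤ R :=
      ae_forall_norm_comp_le (ψ := id) hXmeas hXlaw hR
    filter_upwards [hsmall, eventually_ne_atTop 0] with n hn hn0
    filter_upwards [hXR] with ω hω hbad i
    have hlt : dev n ω < η * h n := not_le.1 hbad
    have hhat := hehat n ω
    rw [← coe_empCovCLM] at hhat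
    have hh := hpos n
    have hx : ‖x - X i ω‖ ≤ ‖x‖ + |R| :=
      (norm_sub_le _ _).trans (add_le_add le_rfl ((hω i).trans (le_abs_self R)))
    calc |‖proj (ehat n ω) (x - X i ω)‖ - ‖proj e (x - X i ω)‖|
        ≤ Real.sqrt D * (2 / g * (η * h n)) * ‖x - X i ω‖ := by
          refine abs_norm_proj_sub_norm_proj_le he.orthonormal hhat.orthonormal he.eigen hhat.eigen
            ht hg (empCovCLM_symm _ _) hgap
            (fun w hw j => hhat.rayleigh_le (isCompactOperator_empCovCLM _ _) (empCovCLM_symm _ _)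
              (empCovCLM_nonneg _ _) hw j) (by positivity) (fun v => ?_) hn.le _
          exact (hdev n ω v hn0).trans (by gcongr)
      _ ≤ Real.sqrt D * (2 / g * (η * h n)) * (‖x‖ + |R|) := by gcongr
      _ = η * M * h n := by rw [hM]; ring
      _ ≤ ε * h n := by gcongr

end Main

end PCAKernel

theorem proposition2
    {H : Type*} [NormedAddCommGroup H] [InnerProductSpace ℝ H] [CompleteSpace H]
    [TopologicalSpace.SeparableSpace H] [MeasurableSpace H] [BorelSpace H]
    {Ω : Type*} [MeasurableSpace Ω] (P : Measure Ω) [IsProbabilityMeasure P]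
    -- the law `μ` of `X`: centered, nonatomic, with bounded support
    (μ : Measure H) [IsProbabilityMeasure μ]
    (hnonatomic : ∀ y, μ {y} = 0)
    (hcentered : ∫ y, y ∂μ = 0)
    (hbounded : ∃ R : ℝ, ∀ᵐ y ∂μ, ‖y‖ ≤ R)
    -- the i.i.d. sample with law `μ`
    (X : ℕ → Ω → H) (hXmeas : ∀ i, Measurable (X i)) (hXindep : iIndepFun X P)
    (hXlaw : ∀ i, P.map (X i) = μ)
    -- the leading eigenvectors and eigenvalues of the covariance operator
    (D : ℕ) (hD : 2 < D) (e : Fin D → H) (lam : Fin D → ℝ)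
    (he : PCAKernel.IsLeadingEigensystem (PCAKernel.covOp μ) e lam)
    (hsep : PCAKernel.IsSeparated (PCAKernel.covOp μ) e lam)
    -- any choice of leading empirical eigenvectors for which the projector is a random operator
    (ehat : ℕ → Ω → Fin D → H) (lamhat : ℕ → Ω → Fin D → ℝ)
    (hehat : ∀ n ω, PCAKernel.IsLeadingEigensystem
      (PCAKernel.empCovOp (fun i => X i ω) n) (ehat n ω) (lamhat n ω))
    (hehatmeas : ∀ n v, Measurable fun ω => PCAKernel.proj (ehat n ω) v)
    (K : ℝ → ℝ) (hK : PCAKernel.IsKernel K) :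
    ∀ᵐ x ∂μ,
      PCAKernel.RegularlyVaryingAtZero (PCAKernel.smallBall μ (PCAKernel.proj e) x) D →
      ∀ h : ℕ → ℝ, (∀ n, 0 < h n) → Antitone h → Tendsto h atTop (𝓝 0) →
        Tendsto (fun n : ℕ => n * PCAKernel.smallBall μ (PCAKernel.proj e) x (h n) / Real.log n)
          atTop atTop →
        (∀ᵐ ω ∂P,
          (fun n => PCAKernel.kernelSum K (PCAKernel.proj (ehat n ω)) (fun i => X i ω) x n (h n))
            ~[atTop]
          (fun n => PCAKernel.kernelSum K (PCAKernel.proj e) (fun i => X i ω) x n (h n))) ∧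
        (fun n => ∫ ω,
            PCAKernel.kernelSum K (PCAKernel.proj (ehat n ω)) (fun i => X i ω) x n (h n) ^ 2 ∂P)
          ~[atTop]
        (fun n => ∫ ω,
            PCAKernel.kernelSum K (PCAKernel.proj e) (fun i => X i ω) x n (h n) ^ 2 ∂P) := by

  obtain ⟨R, hR⟩ := hbounded
  -- No exceptional set of points `x` is needed.
  refine Eventually.of_forall fun x hF h hpos _ hlim hlog => ?_
  have hD0 : 0 < D := by omega
  obtain ⟨C, hC, hrate⟩ := PCAKernel.exists_inv_pow_bandwidth_le hF hD
    (fun s => measureReal_nonneg) (fun s => measureReal_le_one) hpos hlim hlog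
  have hpert := PCAKernel.isNegligiblePerturbation_proj hR hXmeas hXindep hXlaw hD0 he hsep hehat x
    hpos hlim hC.le hrate
  exact ⟨PCAKernel.kernelSum_isEquivalent_ae hXmeas hXindep hXlaw hK hD0 hF hpos hlim hlog hpert,
    PCAKernel.integral_kernelSum_sq_isEquivalent hXmeas hXindep hXlaw hK hD0 hF hpos hlim hlog
      hehatmeas hpert⟩
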